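/- Let $M=-\mathbb R\times S^4$ be the product of $\mathbb R$, with negative definite metric, and the round sphere $S^4=\{x_1^2+\dots+x_5^2=R^2\}$ of radius $R>0$, with lorentzian product metric $g$ and Levi-Civita connection $\nabla$, and let $\varphi=c\,\partial_0$ be a parallel vector field, so that $|\varphi|^2=g(\varphi,\varphi)=-c^2$. Clifford multiplication is normalised by $u\cdot v+v\cdot u=-2g(u,v)$. The spinor bundle of $M$ is the bundle of irreducible Clifford modules $\Sigma\simeq\mathbb H^2$ (right quaternionic, of real rank $8$) on which the volume element acts as the identity, and $r=\mathrm{diag}(i,-i)\in\mathfrak{su}(2)=\mathfrak{sp}(1)$ acts on spinors through the quaternionic structure, so that $r$ commutes with Clifford multiplication and $r^2=-1$. A Killing spinor is a smooth spinor field $\epsilon$ with $$\nabla_X\epsilon=\tfrac14\bigl(X\cdot\varphi\cdot{}+3g(X,\varphi)\bigr)\,r\,\epsilon\qquad\text{for all tangent vectors }X .$$ For a Killing vector field $\xi$ let $L_\xi$ be the spinorial Lie derivative, $L_\xi\epsilon=\nabla_\xi\epsilon-\tfrac14\,d\xi^\flat\cdot\epsilon$, where a two-form $F$ acts by $\tfrac12F_{\mu\nu}\gamma^{\mu\nu}$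 (with these conventions, this is the sign for which $L_\xi(Y\cdot\epsilon)=[\xi,Y]\cdot\epsilon+Y\cdot L_\xi\epsilon$). Say that $\xi$ preserves some supersymmetry if there is a non-zero Killing spinor $\epsilon$ with $L_\xi\epsilon=0$, and let the preserved fraction $\nu$ be the real dimension of the space of such Killing spinors (with $0$ included), divided by $8$. Suppose that $R^2|\varphi|^2=-4$. Then the background is maximally supersymmetric: the space of all Killing spinors has real dimension $8$. For $\beta_1,\beta_2\in\mathbb R$ consider the Killing vector field $\xi=\partial_0+\beta_1R_{12}+\beta_2R_{34}$, where $R_{ij}=x_i\partial_j-x_j\partial_i$. Then $\xi$ preserves some supersymmetry if and only if $$(\beta_1+\beta_2)^2=-|\varphi|^2\quad\text{or}\quad(\beta_1-\beta_2)^2=-|\varphi|^2 ,$$ and in that case $\nu=\tfrac12$ if $\beta_1\beta_2=0$, and $\nu=\tfrac14$ if $\beta_1\beta_2\neq0$. -/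

import Mathlib

open scoped Manifold ContDiff Quaternion

noncomputable section

namespace TimeSphere

/-- Euclidean `ℝ⁵`; the coordinates `x¹, …, x⁵` are indexed by `0, …, 4`. -/
abbrev E5 : Type := EuclideanSpace ℝ (Fin 5)

/-- The vector space underlying `ℝ^{1,5}`: the time coordinate `x⁰` and the five space
coordinates. -/
abbrev Ambient : Type := ℝ × E5

/-- The Minkowski inner product of `ℝ^{1,5}`, of mostly plus signature. -/
def minkowski (a b : Ambient) : ℝ := -(a.1 * b.1) + inner ℝ a.2 b.2

/-- The smooth manifold `ℝ × S⁴`. The second factor is Mathlib's unit sphere; the radius `R` of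
the round sphere enters through the embedding `embed R`. -/
abbrev Spacetime : Type := ℝ × Metric.sphere (0 : E5) 1

/-- The model with corners of the smooth manifold `ℝ × S⁴`. -/
abbrev IM : ModelWithCorners ℝ (ℝ × EuclideanSpace ℝ (Fin 4))
    (ModelProd ℝ (EuclideanSpace ℝ (Fin 4))) :=
  𝓘(ℝ, ℝ).prod (𝓡 4)

/-- The tangent space of `ℝ × S⁴` at `p`. -/
abbrev Tangent (p : Spacetime) : Type := TangentSpace IM p

/-- The embedding of `ℝ × S⁴` in `ℝ^{1,5}` with image `ℝ × {x | |x| = R}`. -/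
def embed (R : ℝ) (p : Spacetime) : Ambient := (p.1, R • (p.2 : E5))

/-- The outward unit normal of the hypersurface `embed R` at `p` (its time component is zero). -/
def normal (p : Spacetime) : E5 := (p.2 : E5)

/-- The differential at `p` of the embedding `embed R`. -/
def push (R : ℝ) (p : Spacetime) : Tangent p →L[ℝ] Ambient := mvfderiv IM (embed R) p

/-- The lorentzian product metric `g` of `-ℝ × S⁴`, with `S⁴` round of radius `R`: the metric
induced from `ℝ^{1,5}`. -/
def metric (R : ℝ) (p : Spacetime) (X Y : Tangent p) : ℝ :=
  minkowski (push R p X) (push R p Y)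

/-- The orthogonal projection of `ℝ^{1,5}` onto the image of the tangent space at `p`. -/
def tangentPart (p : Spacetime) (a : Ambient) : Ambient :=
  (a.1, a.2 - (inner ℝ (normal p) a.2) • normal p)

/-- The tangent vector at `p` whose image in `ℝ^{1,5}` is the orthogonal projection of `a`, see
`push_proj`. In particular `proj R p (push R p X) = X`, see `proj_push`. -/
def proj (R : ℝ) (p : Spacetime) (a : Ambient) : Tangent p :=
  Function.invFun (push R p) (tangentPart p a)

instance factE5 : Fact (Module.finrank ℝ E5 = 4 + 1) := ⟨by simp⟩

/-- The inclusion of the unit sphere in `ℝ⁵`. -/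
abbrev incl : Metric.sphere (0 : E5) 1 → E5 := (↑)

lemma contMDiff_incl : ContMDiff (𝓡 4) 𝓘(ℝ, E5) ∞ incl :=
  contMDiff_coe_sphere

lemma hasMFDerivAt_embed (R : ℝ) (p : Spacetime) :
    HasMFDerivAt IM 𝓘(ℝ, Ambient) (embed R) p
      ((ContinuousLinearMap.fst ℝ ℝ (EuclideanSpace ℝ (Fin 4))).prod
        (R • (mvfderiv (𝓡 4) incl p.2).comp
          (ContinuousLinearMap.snd ℝ ℝ (EuclideanSpace ℝ (Fin 4))))) := by
  have h1 := hasMFDerivAt_fst (I := 𝓘(ℝ, ℝ)) (I' := 𝓡 4) p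
  have h2 := hasMFDerivAt_snd (I := 𝓘(ℝ, ℝ)) (I' := 𝓡 4) p
  have h3 := ((contMDiff_incl.mdifferentiable (by simp)) p.2).hasMFDerivAt
  have h4 := (h3.comp p h2).const_smul R
  exact ⟨h1.1.prodMk h4.1, h1.2.prodMk h4.2⟩

lemma push_apply (R : ℝ) (p : Spacetime) (X : Tangent p) :
    push R p X = (X.1, R • mvfderiv (𝓡 4) incl p.2 X.2) := by
  have h := (hasMFDerivAt_embed R p).mfderiv
  unfold push mvfderiv
  rw [h]
  rfl

lemma inner_normal_push (R : ℝ) (p : Spacetime) (X : Tangent p) :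
    inner ℝ (normal p) (push R p X).2 = 0 := by
  have h : mvfderiv (𝓡 4) incl p.2 X.2 ∈ (mvfderiv (𝓡 4) incl p.2).range := ⟨_, rfl⟩
  rw [show (mvfderiv (𝓡 4) incl p.2).range = _ from range_mvfderiv_subtypeVal (n := 4) p.2] at h
  rw [push_apply, inner_smul_right, normal, Submodule.mem_orthogonal_singleton_iff_inner_right.1 h,
    mul_zero]

lemma push_injective {R : ℝ} (hR : R ≠ 0) (p : Spacetime) : Function.Injective (push R p) := by
  intro X Y h
  rw [push_apply, push_apply] at h
  obtain ⟨h1, h2⟩ := Prod.ext_iff.1 h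
  exact Prod.ext h1
    (injective_mvfderiv_subtypeVal_sphere p.2 (smul_right_injective E5 hR h2))

lemma norm_normal (p : Spacetime) : inner ℝ (normal p) (normal p) = 1 := by
  rw [real_inner_self_eq_norm_sq, normal, mem_sphere_zero_iff_norm.1 p.2.2]; norm_num

lemma push_proj {R : ℝ} (hR : R ≠ 0) (p : Spacetime) (a : Ambient) :
    push R p (proj R p a) = tangentPart p a := by
  apply Function.invFun_eq
  have h : (R⁻¹ • (tangentPart p a).2) ∈ (ℝ ∙ (p.2 : E5))ᗮ := by
    rw [Submodule.mem_orthogonal_singleton_iff_inner_right]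
    have := norm_normal p
    simp only [tangentPart, inner_smul_right, inner_sub_right, normal] at *
    rw [this]; ring
  rw [← range_mvfderiv_subtypeVal (n := 4) p.2] at h
  obtain ⟨Y, hY⟩ := h
  refine ⟨((tangentPart p a).1, Y), (push_apply R p _).trans (Prod.ext rfl ?_)⟩
  have hY' : mvfderiv (𝓡 4) incl p.2 Y = R⁻¹ • (tangentPart p a).2 := hY
  change R • mvfderiv (𝓡 4) incl p.2 Y = _
  rw [hY', smul_inv_smul₀ hR]

lemma proj_push {R : ℝ} (hR : R ≠ 0) (p : Spacetime) (X : Tangent p) :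
    proj R p (push R p X) = X := by
  apply push_injective hR
  rw [push_proj hR, tangentPart, inner_normal_push, zero_smul, sub_zero]

/-- The spinor module `Σ ≃ ℍ²`, a right quaternionic vector space of real dimension `8`.

The spinor bundle of `-ℝ × S⁴` (the spin structure is unique, as the space is simply connected) is
realised as the restriction of the spinor bundle of the ambient space to the hypersurface, that is,
as the trivial bundle with fibre `Σ`, with the Clifford multiplication `cliff` and the Levi-Civita
spin connection `spinDeriv` below. A spinor field is a function `Spacetime → Spinor`. -/
abbrev Spinor : Type := Fin 2 → ℍ[ℝ]

/-- The quaternion `a + b i + c j + d k`. -/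
def quat (a b c d : ℝ) : ℍ[ℝ] := ⟨a, b, c, d⟩

@[simp] lemma quat_re (a b c d : ℝ) : (quat a b c d).re = a := rfl
@[simp] lemma quat_imI (a b c d : ℝ) : (quat a b c d).imI = b := rfl
@[simp] lemma quat_imJ (a b c d : ℝ) : (quat a b c d).imJ = c := rfl
@[simp] lemma quat_imK (a b c d : ℝ) : (quat a b c d).imK = d := rfl

/-- The action on `ℍ²` of the traceless hermitian quaternionic matrix
`((x⁵, q), (q̄, -x⁵))`, where `q = x⁴ + x¹ i + x² j + x³ k`. These matrices satisfy
`x y + y x = 2 ⟨x, y⟩`, see `pauli_pauli`. -/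
def pauli (x : E5) (s : Spinor) : Spinor :=
  ![x 4 • s 0 + quat (x 3) (x 0) (x 1) (x 2) * s 1,
    star (quat (x 3) (x 0) (x 1) (x 2)) * s 0 - x 4 • s 1]

/-- Clifford multiplication `X · s` of spinors by tangent vectors at `p`. With `ν` the unit normal
of the sphere, `∂₀` acts by `ν` and a vector `X` tangent to the sphere acts by `X ν`. The Clifford
relation `X · Y + Y · X = -2 g(X, Y)` is `cliff_cliff`; the volume element
`∂₀ · e₁ · e₂ · e₃ · e₄` acts by `1` for the orientation in which the tangent frame
`(∂₀, e₁, e₂, e₃, e₄)` at the pole in the direction of `e₅` is positively oriented. -/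
def cliff (R : ℝ) (p : Spacetime) (X : Tangent p) (s : Spinor) : Spinor :=
  (push R p X).1 • pauli (normal p) s + pauli (push R p X).2 (pauli (normal p) s)

lemma pauli_add (x : E5) (s t : Spinor) : pauli x (s + t) = pauli x s + pauli x t := by
  funext k; fin_cases k <;> simp [pauli] <;> ext <;> simp <;> ring

lemma pauli_smul (x : E5) (a : ℝ) (s : Spinor) : pauli x (a • s) = a • pauli x s := by
  funext k; fin_cases k <;> simp [pauli] <;> ext <;> simp <;> ring

lemma add_pauli (x y : E5) (s : Spinor) : pauli (x + y) s = pauli x s + pauli y s := by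
  funext k; fin_cases k <;> simp [pauli] <;> ext <;> simp <;> ring

lemma smul_pauli (x : E5) (a : ℝ) (s : Spinor) : pauli (a • x) s = a • pauli x s := by
  funext k; fin_cases k <;> simp [pauli] <;> ext <;> simp <;> ring

lemma pauli_pauli (x y : E5) (s : Spinor) :
    pauli x (pauli y s) + pauli y (pauli x s) = (2 * inner ℝ x y) • s := by
  funext k
  fin_cases k <;> ext <;> simp [pauli, Fin.sum_univ_succ, PiLp.inner_apply] <;> ring

lemma pauli_pauli_self (x : E5) (s : Spinor) : pauli x (pauli x s) = inner ℝ x x • s := by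
  have h := pauli_pauli x x s
  rw [← two_smul ℝ, mul_smul] at h
  exact smul_right_injective Spinor (two_ne_zero' ℝ) h

lemma cliff_add (R : ℝ) (p : Spacetime) (X : Tangent p) (s t : Spinor) :
    cliff R p X (s + t) = cliff R p X s + cliff R p X t := by
  simp only [cliff, pauli_add, smul_add]; abel

lemma cliff_smul (R : ℝ) (p : Spacetime) (X : Tangent p) (a : ℝ) (s : Spinor) :
    cliff R p X (a • s) = a • cliff R p X s := by
  simp only [cliff, pauli_smul, smul_add, smul_comm a]

/-- The Clifford relation. -/
lemma cliff_cliff (R : ℝ) (p : Spacetime) (X Y : Tangent p) (s : Spinor) :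
    cliff R p X (cliff R p Y s) + cliff R p Y (cliff R p X s) = (-2 * metric R p X Y) • s := by
  have key : ∀ (Z : Tangent p) (t : Spinor),
      pauli (normal p) (pauli (push R p Z).2 t) = -pauli (push R p Z).2 (pauli (normal p) t) := by
    intro Z t
    have h := pauli_pauli (normal p) (push R p Z).2 t
    rw [inner_normal_push, mul_zero, zero_smul] at h
    exact eq_neg_of_add_eq_zero_left h
  have hn := fun t => pauli_pauli_self (normal p) t
  have hneg : ∀ x t, pauli x (-t) = -pauli x t := fun x t => by
    rw [← neg_one_smul ℝ t, pauli_smul, neg_one_smul]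
  have h2 := pauli_pauli (push R p X).2 (push R p Y).2 s
  have h3 : pauli (push R p X).2 (pauli (push R p Y).2 s) =
      (2 * inner ℝ (push R p X).2 (push R p Y).2) • s
        - pauli (push R p Y).2 (pauli (push R p X).2 s) := eq_sub_of_add_eq h2
  simp only [cliff, pauli_add, pauli_smul, key, hn, hneg, norm_normal, one_smul, metric, minkowski,
    h3]
  module

/-- The spin connection `∇_X ψ`, the lift to spinors of the Levi-Civita connection. For a
hypersurface this is the flat derivative `∂_X ψ` corrected by half of the Clifford product of the
shape operator applied to `X` with the normal. It is the connection which commutes with the right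
quaternionic action and with which Clifford multiplication is compatible, see `spinDeriv_cliff`. -/
def spinDeriv (R : ℝ) (ψ : Spacetime → Spinor) (p : Spacetime) (X : Tangent p) : Spinor :=
  mvfderiv IM ψ p X - (1 / (2 * R)) • pauli (push R p X).2 (pauli (normal p) (ψ p))

/-- The Levi-Civita connection `∇_X Y` of the induced metric: the tangential part of the flat
derivative of `Y`. -/
def leviCivita (R : ℝ) (Y : (p : Spacetime) → Tangent p) (p : Spacetime) (X : Tangent p) :
    Tangent p :=
  proj R p (mvfderiv IM (fun q => push R q (Y q)) p X)

/-- `pauli` as a continuous bilinear map. -/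
def pauliL : E5 →L[ℝ] Spinor →L[ℝ] Spinor :=
  LinearMap.toContinuousLinearMap
    ((LinearMap.toContinuousLinearMap : (Spinor →ₗ[ℝ] Spinor) ≃ₗ[ℝ] _).toLinearMap ∘ₗ
      LinearMap.mk₂ ℝ pauli add_pauli (fun a x s => smul_pauli x a s) pauli_add
        (fun a x s => pauli_smul x a s))

lemma pauliL_apply (x : E5) (s : Spinor) : pauliL x s = pauli x s := rfl

lemma mvfderiv_pauli {f : Spacetime → E5} {g : Spacetime → Spinor} {p : Spacetime}
    (hf : MDifferentiableAt IM 𝓘(ℝ, E5) f p) (hg : MDifferentiableAt IM 𝓘(ℝ, Spinor) g p) :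
    MDifferentiableAt IM 𝓘(ℝ, Spinor) (fun q => pauli (f q) (g q)) p ∧
    ∀ X, mvfderiv IM (fun q => pauli (f q) (g q)) p X =
      pauli (f p) (mvfderiv IM g p X) + pauli (mvfderiv IM f p X) (g p) := by
  let f' : (ℝ × EuclideanSpace ℝ (Fin 4)) →L[ℝ] E5 := mfderiv IM 𝓘(ℝ, E5) f p
  let g' : (ℝ × EuclideanSpace ℝ (Fin 4)) →L[ℝ] Spinor := mfderiv IM 𝓘(ℝ, Spinor) g p
  have h1 : HasMFDerivAt IM 𝓘(ℝ, E5 × Spinor) (fun q => (f q, g q)) p (f'.prod g') :=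
    ⟨hf.continuousAt.prodMk hg.continuousAt, hf.hasMFDerivAt.2.prodMk hg.hasMFDerivAt.2⟩
  have h := (pauliL.isBoundedBilinearMap.hasFDerivAt (f p, g p)).hasMFDerivAt.comp p h1
  change HasMFDerivAt IM 𝓘(ℝ, Spinor) (fun q => pauli (f q) (g q)) p _ at h
  refine ⟨h.mdifferentiableAt, fun X => ?_⟩
  unfold mvfderiv
  rw [h.mfderiv]
  rfl

lemma mvfderiv_normal {R : ℝ} (hR : R ≠ 0) (p : Spacetime) :
    MDifferentiableAt IM 𝓘(ℝ, E5) normal p ∧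
    ∀ X, mvfderiv IM normal p X = R⁻¹ • (push R p X).2 := by
  have h1 := (contMDiff_incl.mdifferentiable (by simp)) p.2
  have h2 := mdifferentiableAt_snd (I := 𝓘(ℝ, ℝ)) (I' := 𝓡 4) (x := p)
  have h3 := (h1.hasMFDerivAt.comp p (hasMFDerivAt_snd (I := 𝓘(ℝ, ℝ)) (I' := 𝓡 4) p)).mfderiv
  refine ⟨h1.comp p h2, fun X => ?_⟩
  rw [push_apply, smul_smul, inv_mul_cancel₀ hR, one_smul]
  unfold mvfderiv
  change _ = (NormedSpace.fromTangentSpace _) ((mfderiv (𝓡 4) 𝓘(ℝ, E5) incl p.2) X.2)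
  change (NormedSpace.fromTangentSpace _) (mfderiv IM 𝓘(ℝ, E5) (incl ∘ Prod.snd) p X) = _
  rw [h3]
  rfl

lemma pauli_normal_push (R : ℝ) (p : Spacetime) (X : Tangent p) (s : Spinor) :
    pauli (normal p) (pauli (push R p X).2 s) = -pauli (push R p X).2 (pauli (normal p) s) := by
  have h := pauli_pauli (normal p) (push R p X).2 s
  rw [inner_normal_push, mul_zero, zero_smul] at h
  exact eq_neg_of_add_eq_zero_left h

lemma pauli_neg (x : E5) (s : Spinor) : pauli x (-s) = -pauli x s := by
  rw [← neg_one_smul ℝ s, pauli_smul, neg_one_smul]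

/-- The spin connection is compatible with the Levi-Civita connection:
`∇_X (Y · ψ) = (∇_X Y) · ψ + Y · ∇_X ψ`. -/
theorem spinDeriv_cliff {R : ℝ} (hR : R ≠ 0) (p : Spacetime) (X : Tangent p)
    {Y : (q : Spacetime) → Tangent q} {ψ : Spacetime → Spinor}
    (hY : MDifferentiableAt IM 𝓘(ℝ, Ambient) (fun q => push R q (Y q)) p)
    (hψ : MDifferentiableAt IM 𝓘(ℝ, Spinor) ψ p) :
    spinDeriv R (fun q => cliff R q (Y q) (ψ q)) p X =
      cliff R p (leviCivita R Y p X) (ψ p) + cliff R p (Y p) (spinDeriv R ψ p X) := by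
  obtain ⟨hn, hn'⟩ := mvfderiv_normal hR p
  set W : Spacetime → Ambient := fun q => push R q (Y q) with hW
  have hYd := hY.hasMFDerivAt
  have ha : HasMFDerivAt IM 𝓘(ℝ, ℝ) (fun q => (W q).1) p _ :=
    (ContinuousLinearMap.fst ℝ ℝ E5).hasMFDerivAt.comp p hYd
  have hb : HasMFDerivAt IM 𝓘(ℝ, E5) (fun q => (W q).2) p _ :=
    (ContinuousLinearMap.snd ℝ ℝ E5).hasMFDerivAt.comp p hYd
  have ha' : mvfderiv IM (fun q => (W q).1) p X = (mvfderiv IM W p X).1 := by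
    unfold mvfderiv; rw [ha.mfderiv]; rfl
  have hb' : mvfderiv IM (fun q => (W q).2) p X = (mvfderiv IM W p X).2 := by
    unfold mvfderiv; rw [hb.mfderiv]; rfl
  obtain ⟨h1, h1'⟩ := mvfderiv_pauli hn hψ
  obtain ⟨h2, h2'⟩ := mvfderiv_pauli hb.mdifferentiableAt h1
  have h3 : mvfderiv IM (fun q => cliff R q (Y q) (ψ q)) p X =
      (W p).1 • (pauli (normal p) (mvfderiv IM ψ p X) + pauli (R⁻¹ • (push R p X).2) (ψ p)) +
      (mvfderiv IM W p X).1 • pauli (normal p) (ψ p) +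
      (pauli (W p).2 (pauli (normal p) (mvfderiv IM ψ p X) + pauli (R⁻¹ • (push R p X).2) (ψ p)) +
        pauli (mvfderiv IM W p X).2 (pauli (normal p) (ψ p))) := by
    have h4 := mvfderiv_fun_add (ha.mdifferentiableAt.fun_smul h1) h2
    have h5 := mvfderiv_fun_smul ha.mdifferentiableAt h1
    have h6 := congrArg (fun L => L X) h4
    rw [h5] at h6
    refine h6.trans ?_
    simp only [add_apply, smul_apply,
      ContinuousLinearMap.smulRight_apply, h2', h1', ha', hb', hn']
  have hin : inner ℝ (normal p) (mvfderiv IM W p X).2 =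
      -(R⁻¹ * inner ℝ (push R p X).2 (W p).2) := by
    let n' : (ℝ × EuclideanSpace ℝ (Fin 4)) →L[ℝ] E5 := mfderiv IM 𝓘(ℝ, E5) normal p
    let b' : (ℝ × EuclideanSpace ℝ (Fin 4)) →L[ℝ] E5 :=
      mfderiv IM 𝓘(ℝ, E5) (fun q => (W q).2) p
    have g1 : HasMFDerivAt IM 𝓘(ℝ, E5 × E5) (fun q => (normal q, (W q).2)) p (n'.prod b') :=
      ⟨hn.continuousAt.prodMk hb.mdifferentiableAt.continuousAt,
        hn.hasMFDerivAt.2.prodMk hb.mdifferentiableAt.hasMFDerivAt.2⟩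
    have g2 := ((isBoundedBilinearMap_inner (𝕜 := ℝ) (E := E5)).hasFDerivAt
      (normal p, (W p).2)).hasMFDerivAt.comp p g1
    have g3 : ((fun z : E5 × E5 => inner ℝ z.1 z.2) ∘ fun q => (normal q, (W q).2)) =
        fun _ => (0 : ℝ) := by
      funext q; exact inner_normal_push R q (Y q)
    rw [g3] at g2
    have g4 := congrArg (fun L => L X) (hasMFDerivAt_unique g2 (hasMFDerivAt_const (0 : ℝ) p))
    change inner ℝ (normal p) (mvfderiv IM (fun q => (W q).2) p X) +
      inner ℝ (mvfderiv IM normal p X) (W p).2 = 0 at g4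
    rw [hn', hb', real_inner_smul_left] at g4
    linarith
  have hWp : ∀ s, pauli (normal p) (pauli (W p).2 s) = -pauli (W p).2 (pauli (normal p) s) :=
    pauli_normal_push R p (Y p)
  have hxb : ∀ s, pauli (push R p X).2 (pauli (W p).2 s) =
      (2 * inner ℝ (push R p X).2 (W p).2) • s - pauli (W p).2 (pauli (push R p X).2 s) :=
    fun s => eq_sub_of_add_eq (pauli_pauli _ _ s)
  have hsub : ∀ x y s, pauli (x - y) s = pauli x s - pauli y s := fun x y s => by
    rw [sub_eq_add_neg, ← neg_one_smul ℝ y, add_pauli, smul_pauli, neg_one_smul, sub_eq_add_neg]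
  have hsub' : ∀ x s t, pauli x (s - t) = pauli x s - pauli x t := fun x s t => by
    rw [sub_eq_add_neg, pauli_add, pauli_neg, sub_eq_add_neg]
  have hR2 : 1 / (2 * R) = R⁻¹ / 2 := by field_simp
  have hL : push R p (leviCivita R Y p X) = tangentPart p (mvfderiv IM W p X) := push_proj hR _ _
  unfold spinDeriv
  rw [h3]
  unfold cliff
  rw [hL, hR2]
  change _ - (R⁻¹ / 2) • pauli (push R p X).2 (pauli (normal p) ((W p).1 • pauli (normal p) (ψ p) +
    pauli (W p).2 (pauli (normal p) (ψ p)))) = _ + ((W p).1 • _ + pauli (W p).2 _)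
  simp only [tangentPart, hsub, hsub', pauli_add, pauli_smul, pauli_neg, smul_pauli, hin,
    pauli_normal_push, hWp, hxb, pauli_pauli_self, norm_normal, one_smul]
  module

/-- The exterior derivative `dξ♭` of the one-form `ξ♭ = g(ξ, -)`, by the usual formula
`dξ♭(X, Y) = g(∇_X ξ, Y) - g(∇_Y ξ, X)` for a torsion free metric connection. -/
def dFlat (R : ℝ) (ξ : (p : Spacetime) → Tangent p) (p : Spacetime) (X Y : Tangent p) : ℝ :=
  metric R p (leviCivita R ξ p X) Y - metric R p (leviCivita R ξ p Y) X

/-- The standard orthonormal basis of `ℝ^{1,5}`: `∂₀`, and `e₁, …, e₅`. -/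
def axis : Unit ⊕ Fin 5 → Ambient
  | .inl _ => (1, 0)
  | .inr i => (0, EuclideanSpace.single i 1)

/-- The squared norms `-1, 1, …, 1` of the vectors of the standard basis. -/
def axisSign : Unit ⊕ Fin 5 → ℝ
  | .inl _ => -1
  | .inr _ => 1

/-- The tangential projections `f_A` of the standard basis of `ℝ^{1,5}`. They satisfy
`X = ∑_A ± g(X, f_A) f_A`, see `sum_frame`, so that the inverse metric is `∑_A ± f_A ⊗ f_A` and
contractions may be computed with them as with an orthonormal frame. -/
def frame (R : ℝ) (p : Spacetime) (A : Unit ⊕ Fin 5) : Tangent p := proj R p (axis A)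

lemma sum_frame {R : ℝ} (hR : R ≠ 0) (p : Spacetime) (X : Tangent p) :
    ∑ A, (axisSign A * metric R p X (frame R p A)) • frame R p A = X := by
  apply push_injective hR
  have hm : ∀ A, axisSign A * metric R p X (frame R p A) = match A with
      | .inl _ => (push R p X).1
      | .inr i => (push R p X).2 i := by
    intro A
    have h := inner_normal_push R p X
    rw [real_inner_comm] at h
    rcases A with _ | i <;>
      simp [axisSign, metric, minkowski, frame, push_proj hR, tangentPart, axis, inner_sub_right,
        inner_smul_right, h, EuclideanSpace.inner_single_right]
  have hx : ∑ i, (push R p X).2 i • (EuclideanSpace.single i 1 : E5) = (push R p X).2 := by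
    ext j; simp [Finset.sum_apply, Pi.single_apply]
  have hn : ∑ i, ((push R p X).2 i * normal p i) = 0 := by
    rw [← inner_normal_push R p X]; simp [PiLp.inner_apply]
  rw [map_sum]
  simp only [hm, map_smul]
  simp only [Fintype.sum_sum_type, Finset.univ_unique, Finset.sum_singleton,
    frame, push_proj hR, tangentPart, axis]
  refine Prod.ext ?_ ?_
  · simp [Prod.fst_sum]
  · simp only [Prod.snd_add, Prod.snd_sum, Prod.smul_mk, inner_zero_right, zero_smul, sub_zero,
      smul_zero, zero_add, smul_sub, Finset.sum_sub_distrib, hx]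
    simp [smul_smul, ← Finset.sum_smul, hn, EuclideanSpace.inner_single_right]

/-- The Clifford action `(1/2) F_{μν} γ^μ γ^ν s = (1/2) F_{μν} γ^{μν} s` of a two-form `F`; the
indices are raised and contracted by means of the vectors `f_A`. -/
def twoFormAct (R : ℝ) (p : Spacetime) (F : Tangent p → Tangent p → ℝ) (s : Spinor) : Spinor :=
  (1 / 2 : ℝ) • ∑ A, ∑ B, (axisSign A * axisSign B * F (frame R p A) (frame R p B)) •
    cliff R p (frame R p A) (cliff R p (frame R p B) s)

/-- The spinorial Lie derivative `L_ξ ψ` along a Killing vector field `ξ`. With the Clifford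
relation `X · Y + Y · X = -2 g(X, Y)` the two-form term has the sign written here; this is
the sign for which `L_ξ (Y · ψ) = [ξ, Y] · ψ + Y · L_ξ ψ`, see `lieDeriv_cliff`. -/
def lieDeriv (R : ℝ) (ξ : (p : Spacetime) → Tangent p) (ψ : Spacetime → Spinor) (p : Spacetime) :
    Spinor :=
  spinDeriv R ψ p (ξ p) - (1 / 4 : ℝ) • twoFormAct R p (dFlat R ξ p) (ψ p)

lemma spinDeriv_add (R : ℝ) {ψ χ : Spacetime → Spinor} {p : Spacetime}
    (hψ : MDifferentiableAt IM 𝓘(ℝ, Spinor) ψ p) (hχ : MDifferentiableAt IM 𝓘(ℝ, Spinor) χ p)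
    (X : Tangent p) : spinDeriv R (ψ + χ) p X = spinDeriv R ψ p X + spinDeriv R χ p X := by
  simp only [spinDeriv, mvfderiv_add hψ hχ, Pi.add_apply, pauli_add, add_apply]
  module

lemma spinDeriv_smul (R : ℝ) {ψ : Spacetime → Spinor} {p : Spacetime}
    (hψ : MDifferentiableAt IM 𝓘(ℝ, Spinor) ψ p) (a : ℝ) (X : Tangent p) :
    spinDeriv R (a • ψ) p X = a • spinDeriv R ψ p X := by
  have h : mvfderiv IM (a • ψ) p X = a • mvfderiv IM ψ p X := by
    unfold mvfderiv
    rw [const_smul_mfderiv hψ a]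
    rfl
  simp only [spinDeriv, h, Pi.smul_apply, pauli_smul]
  module

lemma twoFormAct_add (R : ℝ) (p : Spacetime) (F : Tangent p → Tangent p → ℝ) (s t : Spinor) :
    twoFormAct R p F (s + t) = twoFormAct R p F s + twoFormAct R p F t := by
  simp only [twoFormAct, cliff_add, smul_add, Finset.sum_add_distrib]

lemma twoFormAct_smul (R : ℝ) (p : Spacetime) (F : Tangent p → Tangent p → ℝ) (a : ℝ)
    (s : Spinor) : twoFormAct R p F (a • s) = a • twoFormAct R p F s := by
  simp only [twoFormAct, cliff_smul, Finset.smul_sum, smul_comm a]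

lemma sum_metric_frame {R : ℝ} (hR : R ≠ 0) (p : Spacetime) (Y Z : Tangent p) :
    ∑ A, axisSign A * metric R p Y (frame R p A) * metric R p Z (frame R p A) =
      metric R p Z Y := by
  have h := congrArg (push R p) (sum_frame hR p Y)
  rw [map_sum] at h
  simp only [map_smul] at h
  conv_rhs => rw [metric, ← h]
  simp only [minkowski, Prod.fst_sum, Prod.snd_sum, Prod.smul_fst, Prod.smul_snd, inner_sum,
    inner_smul_right, Finset.mul_sum, ← Finset.sum_neg_distrib, ← Finset.sum_add_distrib, smul_eq_mul]
  refine Finset.sum_congr rfl fun A _ => ?_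
  rw [metric, metric, minkowski, minkowski]; ring

lemma sum_cliff_frame {R : ℝ} (hR : R ≠ 0) (p : Spacetime) (X : Tangent p) (s : Spinor) :
    ∑ A, (axisSign A * metric R p X (frame R p A)) • cliff R p (frame R p A) s =
      cliff R p X s := by
  have h := congrArg (push R p) (sum_frame hR p X)
  rw [map_sum] at h
  simp only [map_smul] at h
  have hs : ∀ (f : Unit ⊕ Fin 5 → E5), pauli (∑ A, f A) (pauli (normal p) s) =
      ∑ A, pauli (f A) (pauli (normal p) s) := fun f => by
    simp only [← pauliL_apply, map_sum, sum_apply]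
  conv_rhs => rw [cliff, ← h]
  simp only [Prod.fst_sum, Prod.snd_sum, Prod.smul_fst, Prod.smul_snd, hs, smul_pauli,
    Finset.sum_smul, ← Finset.sum_add_distrib, cliff, smul_add, smul_smul, smul_eq_mul]

/-- Naturality of the spinorial Lie derivative along a Killing vector field:
`L_ξ (Y · ψ) = [ξ, Y] · ψ + Y · L_ξ ψ`, where `[ξ, Y] = ∇_ξ Y - ∇_Y ξ`. -/
theorem lieDeriv_cliff {R : ℝ} (hR : R ≠ 0) (p : Spacetime)
    {ξ Y : (q : Spacetime) → Tangent q} {ψ : Spacetime → Spinor}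
    (hξ : ∀ X Z : Tangent p,
      metric R p (leviCivita R ξ p X) Z + metric R p (leviCivita R ξ p Z) X = 0)
    (hY : MDifferentiableAt IM 𝓘(ℝ, Ambient) (fun q => push R q (Y q)) p)
    (hψ : MDifferentiableAt IM 𝓘(ℝ, Spinor) ψ p) :
    lieDeriv R ξ (fun q => cliff R q (Y q) (ψ q)) p =
      cliff R p (leviCivita R Y p (ξ p)) (ψ p) - cliff R p (leviCivita R ξ p (Y p)) (ψ p) +
        cliff R p (Y p) (lieDeriv R ξ ψ p) := by
  have hk : ∀ X Z : Tangent p, dFlat R ξ p X Z = 2 * metric R p (leviCivita R ξ p X) Z :=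
    fun X Z => by have := hξ X Z; rw [dFlat]; linarith
  have hk' : ∀ X Z : Tangent p, metric R p (leviCivita R ξ p X) Z =
      -metric R p (leviCivita R ξ p Z) X := fun X Z => by have := hξ X Z; linarith
  have hneg : ∀ (X : Tangent p) s, cliff R p X (-s) = -cliff R p X s := fun X s => by
    rw [← neg_one_smul ℝ s, cliff_smul, neg_one_smul]
  have hsum : ∀ (X : Tangent p) (f : Unit ⊕ Fin 5 → Spinor),
      cliff R p X (∑ A, f A) = ∑ A, cliff R p X (f A) := fun X f =>
    map_sum (⟨⟨cliff R p X, cliff_add R p X⟩, cliff_smul R p X⟩ : Spinor →ₗ[ℝ] Spinor) f _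
  have hcomm : ∀ (A B : Tangent p) s, cliff R p A (cliff R p B (cliff R p (Y p) s)) =
      cliff R p (Y p) (cliff R p A (cliff R p B s)) + (-2 * metric R p (Y p) B) • cliff R p A s
        + (2 * metric R p (Y p) A) • cliff R p B s := by
    intro A B s
    have h1 : cliff R p B (cliff R p (Y p) s) = (-2 * metric R p (Y p) B) • s
        - cliff R p (Y p) (cliff R p B s) := by
      rw [← cliff_cliff]; abel
    have h2 : cliff R p A (cliff R p (Y p) (cliff R p B s)) =
        (-2 * metric R p (Y p) A) • cliff R p B s
        - cliff R p (Y p) (cliff R p A (cliff R p B s)) := by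
      rw [← cliff_cliff]; abel
    rw [h1, sub_eq_add_neg, cliff_add, cliff_smul, hneg, h2]
    module
  have key : twoFormAct R p (dFlat R ξ p) (cliff R p (Y p) (ψ p)) =
      cliff R p (Y p) (twoFormAct R p (dFlat R ξ p) (ψ p)) +
        (4 : ℝ) • cliff R p (leviCivita R ξ p (Y p)) (ψ p) := by
    have e1 : ∑ A, ∑ B, (axisSign A * axisSign B * dFlat R ξ p (frame R p A) (frame R p B)) •
        (-2 * metric R p (Y p) (frame R p B)) • cliff R p (frame R p A) (ψ p) =
        (4 : ℝ) • cliff R p (leviCivita R ξ p (Y p)) (ψ p) := by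
      rw [← sum_cliff_frame hR, Finset.smul_sum]
      refine Finset.sum_congr rfl fun A _ => ?_
      rw [hk', ← sum_metric_frame hR p (Y p)]
      simp only [smul_smul, ← Finset.sum_smul, hk]
      congr 1
      simp only [Finset.mul_sum, ← Finset.sum_neg_distrib]
      exact Finset.sum_congr rfl fun B _ => by ring
    have e2 : ∑ A, ∑ B, (axisSign A * axisSign B * dFlat R ξ p (frame R p A) (frame R p B)) •
        (2 * metric R p (Y p) (frame R p A)) • cliff R p (frame R p B) (ψ p) =
        (4 : ℝ) • cliff R p (leviCivita R ξ p (Y p)) (ψ p) := by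
      rw [Finset.sum_comm, ← e1]
      refine Finset.sum_congr rfl fun B _ => Finset.sum_congr rfl fun A _ => ?_
      rw [smul_smul, smul_smul, hk, hk, hk' (frame R p A)]
      congr 1; ring
    simp only [twoFormAct, hcomm, smul_add, Finset.sum_add_distrib, e1, e2, cliff_smul, hsum]
    module
  unfold lieDeriv
  rw [spinDeriv_cliff hR p (ξ p) hY hψ, key, sub_eq_add_neg (spinDeriv R ψ p (ξ p)), cliff_add,
    hneg, cliff_smul]
  module

lemma lieDeriv_add (R : ℝ) (ξ : (p : Spacetime) → Tangent p) {ψ χ : Spacetime → Spinor}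
    {p : Spacetime} (hψ : MDifferentiableAt IM 𝓘(ℝ, Spinor) ψ p)
    (hχ : MDifferentiableAt IM 𝓘(ℝ, Spinor) χ p) :
    lieDeriv R ξ (ψ + χ) p = lieDeriv R ξ ψ p + lieDeriv R ξ χ p := by
  simp only [lieDeriv, spinDeriv_add R hψ hχ, Pi.add_apply, twoFormAct_add]
  module

lemma lieDeriv_smul (R : ℝ) (ξ : (p : Spacetime) → Tangent p) {ψ : Spacetime → Spinor}
    {p : Spacetime} (hψ : MDifferentiableAt IM 𝓘(ℝ, Spinor) ψ p) (a : ℝ) :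
    lieDeriv R ξ (a • ψ) p = a • lieDeriv R ξ ψ p := by
  simp only [lieDeriv, spinDeriv_smul R hψ, Pi.smul_apply, twoFormAct_smul]
  module

/-- The action of `r`. It is right multiplication by the quaternion `i`; as an element of
`𝔰𝔲(2) = 𝔰𝔭(1)` this is `diag(i, -i)`. It commutes with Clifford multiplication and has square `-1`. -/
def rAct (s : Spinor) : Spinor := fun k => s k * quat 0 1 0 0

lemma rAct_add (s t : Spinor) : rAct (s + t) = rAct s + rAct t := by
  funext k; simp [rAct, add_mul]

lemma rAct_smul (a : ℝ) (s : Spinor) : rAct (a • s) = a • rAct s := by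
  funext k; simp [rAct]

/-- The parallel vector field `φ = c ∂₀`. -/
def parallelField (R c : ℝ) (p : Spacetime) : Tangent p := proj R p (c, 0)

/-- `β_X s = (1/4) (X · φ · + 3 g(X, φ)) r s`. -/
def beta (R c : ℝ) (p : Spacetime) (X : Tangent p) (s : Spinor) : Spinor :=
  (1 / 4 : ℝ) • rAct (cliff R p X (cliff R p (parallelField R c p) s) + (3 * metric R p X (parallelField R c p)) • s)

/-- The generator `R_{ij} = x_i ∂_j - x_j ∂_i` of the rotations in the plane `(i, j)`. -/
def rotation (i j : Fin 5) (x : E5) : E5 :=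
  x i • EuclideanSpace.single j 1 - x j • EuclideanSpace.single i 1

/-- The Killing vector field `ξ = ∂₀ + β₁ R₁₂ + β₂ R₃₄`, see `push_killingField`. -/
def killingField (R β₁ β₂ : ℝ) (p : Spacetime) : Tangent p :=
  proj R p (1, β₁ • rotation 0 1 (embed R p).2 + β₂ • rotation 2 3 (embed R p).2)

lemma push_killingField {R : ℝ} (hR : R ≠ 0) (β₁ β₂ : ℝ) (p : Spacetime) :
    push R p (killingField R β₁ β₂ p) =
      (1, β₁ • rotation 0 1 (embed R p).2 + β₂ • rotation 2 3 (embed R p).2) := by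
  have h : ∀ i j, inner ℝ (normal p) (rotation i j (embed R p).2) = 0 := by
    intro i j
    simp [rotation, normal, embed, inner_sub_right, inner_smul_right,
      EuclideanSpace.inner_single_right]
    ring
  rw [killingField, push_proj hR, tangentPart]
  simp [inner_add_right, inner_smul_right, h]

lemma metric_parallelField {R : ℝ} (hR : R ≠ 0) (c : ℝ) (p : Spacetime) :
    metric R p (parallelField R c p) (parallelField R c p) = -c ^ 2 := by
  simp [metric, parallelField, push_proj hR, tangentPart, minkowski, sq]

lemma beta_add (R c : ℝ) (p : Spacetime) (X : Tangent p) (s t : Spinor) :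
    beta R c p X (s + t) = beta R c p X s + beta R c p X t := by
  simp only [beta, cliff_add, rAct_add, smul_add]; abel

lemma beta_smul (R c : ℝ) (p : Spacetime) (X : Tangent p) (a : ℝ) (s : Spinor) :
    beta R c p X (a • s) = a • beta R c p X s := by
  simp only [beta, cliff_smul, rAct_smul, rAct_add]; module

lemma mdifferentiableAt_of_smooth {ψ : Spacetime → Spinor}
    (h : ContMDiff IM 𝓘(ℝ, Spinor) ∞ ψ) (p : Spacetime) :
    MDifferentiableAt IM 𝓘(ℝ, Spinor) ψ p := h.mdifferentiable (by simp) p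

/-- The space `S` of Killing spinors: the smooth spinor fields with `∇_X ψ - β_X ψ = 0` for all
tangent vectors `X`. -/
def killingSpinors (R c : ℝ) : Submodule ℝ (Spacetime → Spinor) where
  carrier := {ψ | ContMDiff IM 𝓘(ℝ, Spinor) ∞ ψ ∧
    ∀ (p : Spacetime) (X : Tangent p), spinDeriv R ψ p X - beta R c p X (ψ p) = 0}
  zero_mem' := by
    refine ⟨contMDiff_const, fun p X => ?_⟩
    have h := spinDeriv_smul R (ψ := 0) (p := p) (mdifferentiableAt_const (c := 0)) 0 X
    have h' := beta_smul R c p X 0 0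
    simp only [zero_smul] at h h'
    simp [h, h']
  add_mem' := by
    rintro ψ χ ⟨h1, h2⟩ ⟨h3, h4⟩
    refine ⟨h1.add h3, fun p X => ?_⟩
    rw [spinDeriv_add R (mdifferentiableAt_of_smooth h1 p) (mdifferentiableAt_of_smooth h3 p),
      Pi.add_apply, beta_add, add_sub_add_comm, h2, h4, add_zero]
  smul_mem' := by
    rintro a ψ ⟨h1, h2⟩
    refine ⟨(contMDiff_const (I := IM) (I' := 𝓘(ℝ, ℝ)) (c := a)).smul h1, fun p X => ?_⟩
    rw [spinDeriv_smul R (mdifferentiableAt_of_smooth h1 p), Pi.smul_apply, beta_smul, ← smul_sub,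
      h2, smul_zero]

/-- The Killing spinors which are invariant under the one-parameter group of `ξ`: the kernel of
`L_ξ` on the space of Killing spinors. -/
def invariantKillingSpinors (R c : ℝ) (ξ : (p : Spacetime) → Tangent p) :
    Submodule ℝ (Spacetime → Spinor) where
  carrier := {ψ | ψ ∈ killingSpinors R c ∧ ∀ p, lieDeriv R ξ ψ p = 0}
  zero_mem' := by
    refine ⟨zero_mem _, fun p => ?_⟩
    have h := lieDeriv_smul R ξ (ψ := 0) (p := p) (mdifferentiableAt_const (c := 0)) 0
    simpa only [zero_smul] using h
  add_mem' := by
    rintro ψ χ ⟨h1, h2⟩ ⟨h3, h4⟩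
    refine ⟨add_mem h1 h3, fun p => ?_⟩
    rw [lieDeriv_add R ξ (mdifferentiableAt_of_smooth h1.1 p)
      (mdifferentiableAt_of_smooth h3.1 p), h2, h4, add_zero]
  smul_mem' := by
    rintro a ψ ⟨h1, h2⟩
    refine ⟨Submodule.smul_mem _ a h1, fun p => ?_⟩
    rw [lieDeriv_smul R ξ (mdifferentiableAt_of_smooth h1.1 p), h2, smul_zero]

/-- The fraction `ν` of supersymmetry preserved by `ξ`: the dimension of the space of invariant
Killing spinors divided by the rank of the spinor bundle. -/
def preservedFraction (R c : ℝ) (ξ : (p : Spacetime) → Tangent p) : ℚ :=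
  (Module.finrank ℝ (invariantKillingSpinors R c ξ) : ℚ) / (Module.finrank ℝ Spinor : ℚ)

end TimeSphere

end

open TimeSphere

/-! Write `ν` for the unit normal, acting through `pauli`, so that `ν² = 1`, and put `c = 2ε/R`; the
hypothesis says exactly `ε² = 1`. In the flat trivialisation the Killing equation becomes `∂_X ψ =
(1/2R) x (ν + ε r) ψ - (ε/R) X⁰ r ψ`, where `x` is the part of `X` tangent to the sphere. The
operator `T = 1 + ε ν r` satisfies `(ν + ε r) T = 2 ε r` because `ε² = 1`, and `∂_X ν = x/R`. Hence
every field `T exp(-a t r) χ` with `χ` constant and `a = ε/R` is a solution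
(`spinorField_mem_killingSpinors`). Conversely, undoing `T` and the phase turns any solution into a
field with zero derivative, hence a constant one, since `ℝ × S⁴` is connected
(`exists_eq_spinorField`). So Killing spinors correspond to constant spinors, eight real dimensions
of them.

Let `A` be the rotation part of `ξ` and `S` its lift to `Σ` (`spinRotation`). The normal terms in
`∇_ξ` and in `dξ♭` cancel, leaving `L_ξ = ∂_ξ + S` (`lieDeriv_killingField`). Passed to the
parameter `χ`, this is the constant operator `S - a r` (`lieDeriv_spinorField`).

On the two quaternionic coordinates `S` is left multiplication by `m k`, with `m = (β₂ - β₁)/2` and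
`m = -(β₁ + β₂)/2`, while `r` is right multiplication by `i`. The equation `m k q = a q i` has a
solution space of real dimension 2 if `m² = a²`, and only `q = 0` otherwise (`finrank_weightSpace`).
As `2a = c`, the conditions read `(β₁ ∓ β₂)² = c²`; both can hold together only if `β₁ β₂ = 0`, and
then they coincide. This gives dimension 4 or 2 out of 8. -/

noncomputable section

namespace TimeSphere

/-! ### Fields with zero derivative on a connected manifold -/

/-- A map on a manifold without boundary is locally constant when its derivative vanishes. -/
theorem isLocallyConstant_of_mfderiv_eq_zero {E H M F : Type*} [NormedAddCommGroup E]
    [NormedSpace ℝ E] [TopologicalSpace H] {I : ModelWithCorners ℝ E H} [I.Boundaryless]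
    [TopologicalSpace M] [ChartedSpace H M] [IsManifold I 1 M]
    [NormedAddCommGroup F] [NormedSpace ℝ F] {f : M → F}
    (hf : MDifferentiable I 𝓘(ℝ, F) f) (h0 : ∀ x X, mvfderiv I f x X = 0) :
    IsLocallyConstant f := by
  rw [IsLocallyConstant.iff_eventually_eq]
  intro x
  -- Absence of boundary makes the chart target open, so it contains a ball; a ball is convex, and
  -- the mean value inequality applies there.
  have hopen : IsOpen (extChartAt I x).target := isOpen_extChartAt_target x
  obtain ⟨δ, hδ, hball⟩ := Metric.isOpen_iff.1 hopen _ (mem_extChartAt_target (I := I) x)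
  set g : E → F := f ∘ (extChartAt I x).symm with hg
  have hd : ∀ z ∈ (extChartAt I x).target, HasFDerivAt g (0 : E →L[ℝ] F) z := by
    intro z hz
    have h1 : MDifferentiableAt 𝓘(ℝ, E) I (extChartAt I x).symm z :=
      (mdifferentiableOn_extChartAt_symm (I := I) (x := x)).mdifferentiableAt (hopen.mem_nhds hz)
    have h2 := (hf ((extChartAt I x).symm z)).hasMFDerivAt.comp z h1.hasMFDerivAt
    have h3 : mfderiv I 𝓘(ℝ, F) f ((extChartAt I x).symm z) = 0 := by
      ext X; exact h0 _ X
    rw [h3, ContinuousLinearMap.zero_comp] at h2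
    exact h2.hasFDerivAt
  have hconst : ∀ z ∈ Metric.ball (extChartAt I x x) δ, g z = g (extChartAt I x x) := by
    intro z hz
    refine (convex_ball _ δ).is_const_of_fderivWithin_eq_zero (𝕜 := ℝ) (f := g)
      (fun w hw => (hd w (hball hw)).differentiableAt.differentiableWithinAt)
      (fun w hw => ?_) hz (Metric.mem_ball_self hδ)
    exact (hd w (hball hw)).hasFDerivWithinAt.fderivWithin
      (Metric.isOpen_ball.uniqueDiffWithinAt hw)
  have hcont := (continuousAt_extChartAt (I := I) x).preimage_mem_nhds
    (Metric.ball_mem_nhds _ hδ)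
  filter_upwards [hcont, extChartAt_source_mem_nhds (I := I) x] with y hy hys
  have := hconst _ hy
  simpa only [hg, Function.comp_apply, (extChartAt I x).left_inv hys,
    extChartAt_to_inv (I := I) x] using this

instance preconnectedSpace_sphere : PreconnectedSpace (Metric.sphere (0 : E5) 1) :=
  isPreconnected_iff_preconnectedSpace.1
    (isPreconnected_sphere
      (by rw [rank_eq_card_basis (EuclideanSpace.basisFun (Fin 5) ℝ).toBasis]; simp) 0 1)

/-- A spinor field on `ℝ × S⁴` with vanishing flat derivative is constant. -/
theorem exists_const_of_mvfderiv_eq_zero {ψ : Spacetime → Spinor}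
    (hψ : MDifferentiable IM 𝓘(ℝ, Spinor) ψ) (h0 : ∀ p X, mvfderiv IM ψ p X = 0) (p q : Spacetime) :
    ψ p = ψ q :=
  (isLocallyConstant_of_mfderiv_eq_zero hψ h0).apply_eq_of_preconnectedSpace p q

/-! ### Algebra of `r`, the phase and the twist -/

lemma rAct_neg (s : Spinor) : rAct (-s) = -rAct s := by
  rw [← neg_one_smul ℝ s, rAct_smul, neg_one_smul]

lemma rAct_sub (s t : Spinor) : rAct (s - t) = rAct s - rAct t := by
  rw [sub_eq_add_neg, rAct_add, rAct_neg, sub_eq_add_neg]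

lemma rAct_rAct (s : Spinor) : rAct (rAct s) = -s := by
  funext k; ext <;> simp [rAct]

lemma rAct_pauli (x : E5) (s : Spinor) : rAct (pauli x s) = pauli x (rAct s) := by
  funext k; fin_cases k <;> simp [pauli, rAct, add_mul, sub_mul, mul_assoc]

lemma pauli_sub (x : E5) (s t : Spinor) : pauli x (s - t) = pauli x s - pauli x t := by
  rw [sub_eq_add_neg, pauli_add, pauli_neg, sub_eq_add_neg]

lemma pauli_normal_normal (p : Spacetime) (s : Spinor) :
    pauli (normal p) (pauli (normal p) s) = s := by
  rw [pauli_pauli_self, norm_normal, one_smul]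

/-- `rAct` as a continuous linear map. -/
def rActL : Spinor →L[ℝ] Spinor :=
  LinearMap.toContinuousLinearMap ⟨⟨rAct, rAct_add⟩, rAct_smul⟩

/-- The action of `exp (-θ r)` on spinors. -/
def phase (θ : ℝ) (s : Spinor) : Spinor := Real.cos θ • s - Real.sin θ • rAct s

lemma phase_add (θ : ℝ) (s t : Spinor) : phase θ (s + t) = phase θ s + phase θ t := by
  simp only [phase, rAct_add]; module

lemma phase_smul (θ a : ℝ) (s : Spinor) : phase θ (a • s) = a • phase θ s := by
  simp only [phase, rAct_smul]; module

lemma phase_zero_right (θ : ℝ) : phase θ 0 = 0 := by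
  simpa using phase_smul θ 0 0

lemma phase_rAct (θ : ℝ) (s : Spinor) : phase θ (rAct s) = rAct (phase θ s) := by
  simp only [phase, rAct_sub, rAct_smul]

lemma phase_phase_neg (θ : ℝ) (s : Spinor) : phase θ (phase (-θ) s) = s := by
  simp only [phase, Real.cos_neg, Real.sin_neg, rAct_sub, rAct_smul, rAct_rAct]
  have h := Real.cos_sq_add_sin_sq θ
  linear_combination (norm := module) h • s

lemma phase_neg_phase (θ : ℝ) (s : Spinor) : phase (-θ) (phase θ s) = s := by
  simpa using phase_phase_neg (-θ) s

/-- The operator `1 + ε ν r` on the fibre at `p`, where `ν` is the unit normal. -/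
def twist (ε : ℝ) (p : Spacetime) (s : Spinor) : Spinor :=
  s + ε • pauli (normal p) (rAct s)

/-- `ν` and `r` commute with `ν² = 1` and `r² = -1`, so `(ν r)² = -1` and the product is `1 + ε²`.
This makes the twist invertible. -/
lemma twist_twist_neg {ε : ℝ} (hε : ε ^ 2 = 1) (p : Spacetime) (s : Spinor) :
    twist ε p (twist (-ε) p s) = (2 : ℝ) • s := by
  simp only [twist, rAct_add, rAct_smul, rAct_pauli, rAct_rAct, pauli_add, pauli_smul, pauli_neg,
    pauli_normal_normal]
  linear_combination (norm := module) hε • s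

lemma twist_add (ε : ℝ) (p : Spacetime) (s t : Spinor) :
    twist ε p (s + t) = twist ε p s + twist ε p t := by
  simp only [twist, rAct_add, pauli_add]; module

lemma twist_smul (ε a : ℝ) (p : Spacetime) (s : Spinor) :
    twist ε p (a • s) = a • twist ε p s := by
  simp only [twist, rAct_smul, pauli_smul]; module

/-! ### Flat derivatives of phased and twisted fields -/

lemma mvfderiv_rAct {ψ : Spacetime → Spinor} {p : Spacetime}
    (hψ : MDifferentiableAt IM 𝓘(ℝ, Spinor) ψ p) :
    MDifferentiableAt IM 𝓘(ℝ, Spinor) (fun q => rAct (ψ q)) p ∧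
    ∀ X, mvfderiv IM (fun q => rAct (ψ q)) p X = rAct (mvfderiv IM ψ p X) := by
  have h : HasMFDerivAt IM 𝓘(ℝ, Spinor) (fun q => rAct (ψ q)) p _ :=
    rActL.hasMFDerivAt.comp p hψ.hasMFDerivAt
  refine ⟨h.mdifferentiableAt, fun X => ?_⟩
  unfold mvfderiv
  rw [h.mfderiv]
  rfl

lemma mvfderiv_comp_time {f : ℝ → ℝ} {f' : ℝ} {p : Spacetime} (hf : HasDerivAt f f' p.1) :
    MDifferentiableAt IM 𝓘(ℝ, ℝ) (fun q : Spacetime => f q.1) p ∧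
    ∀ X : Tangent p, mvfderiv IM (fun q : Spacetime => f q.1) p X = X.1 * f' := by
  have h : HasMFDerivAt IM 𝓘(ℝ, ℝ) (fun q : Spacetime => f q.1) p _ :=
    hf.hasFDerivAt.hasMFDerivAt.comp p (hasMFDerivAt_fst (I := 𝓘(ℝ, ℝ)) (I' := 𝓡 4) p)
  refine ⟨h.mdifferentiableAt, fun X => ?_⟩
  unfold mvfderiv
  rw [h.mfderiv]
  rfl

lemma mvfderiv_phase (a : ℝ) {ψ : Spacetime → Spinor} {p : Spacetime}
    (hψ : MDifferentiableAt IM 𝓘(ℝ, Spinor) ψ p) :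
    MDifferentiableAt IM 𝓘(ℝ, Spinor) (fun q => phase (a * q.1) (ψ q)) p ∧
    ∀ X, mvfderiv IM (fun q => phase (a * q.1) (ψ q)) p X =
      phase (a * p.1) (mvfderiv IM ψ p X - (a * X.1) • rAct (ψ p)) := by
  have hl : HasDerivAt (fun t : ℝ => a * t) a p.1 := by
    simpa using (hasDerivAt_id p.1).const_mul a
  obtain ⟨hc, hc'⟩ := mvfderiv_comp_time hl.cos
  obtain ⟨hs, hs'⟩ := mvfderiv_comp_time hl.sin
  obtain ⟨hr, hr'⟩ := mvfderiv_rAct hψ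
  refine ⟨(hc.fun_smul hψ).sub (hs.fun_smul hr), fun X => ?_⟩
  have h1 := mvfderiv_fun_sub (hc.fun_smul hψ) (hs.fun_smul hr)
  rw [mvfderiv_fun_smul hc hψ, mvfderiv_fun_smul hs hr] at h1
  refine (congrArg (fun L => L X) h1).trans ?_
  simp only [sub_apply, add_apply, smul_apply, ContinuousLinearMap.smulRight_apply, hc', hs', hr',
    phase, rAct_sub, rAct_smul, rAct_rAct]
  module

/-- The extra term comes from the normal: it is the position on the unit sphere, whereas `push` is
scaled by `R`, hence the factor `R⁻¹`. -/
lemma mvfderiv_twist {R : ℝ} (hR : R ≠ 0) (ε : ℝ) {ψ : Spacetime → Spinor} {p : Spacetime}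
    (hψ : MDifferentiableAt IM 𝓘(ℝ, Spinor) ψ p) :
    MDifferentiableAt IM 𝓘(ℝ, Spinor) (fun q => twist ε q (ψ q)) p ∧
    ∀ X, mvfderiv IM (fun q => twist ε q (ψ q)) p X =
      twist ε p (mvfderiv IM ψ p X) + (ε * R⁻¹) • pauli (push R p X).2 (rAct (ψ p)) := by
  obtain ⟨hn, hn'⟩ := mvfderiv_normal hR p
  obtain ⟨hr, hr'⟩ := mvfderiv_rAct hψ
  obtain ⟨hp, hp'⟩ := mvfderiv_pauli hn hr
  have hc := mdifferentiableAt_const (I := IM) (I' := 𝓘(ℝ, ℝ)) (c := ε) (x := p)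
  refine ⟨hψ.add (hc.fun_smul hp), fun X => ?_⟩
  have h1 := mvfderiv_fun_add hψ (hc.fun_smul hp)
  rw [mvfderiv_fun_smul hc hp, mvfderiv_const] at h1
  refine (congrArg (fun L => L X) h1).trans ?_
  simp only [add_apply, smul_apply, ContinuousLinearMap.smulRight_apply, hp', hr', hn', twist,
    smul_pauli, zero_apply]
  module

/-! ### Solving the Killing spinor equation -/

/-- `φ` acts as `c ν`, so `ν² = 1` reduces `X · φ` to `c X⁰ + c x`. Adding `3 g(X, φ) = -3 c X⁰`
leaves `c x - 2 c X⁰`. -/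
lemma beta_eq {R : ℝ} (hR : R ≠ 0) (c : ℝ) (p : Spacetime) (X : Tangent p) (s : Spinor) :
    beta R c p X s =
      (c / 4) • pauli (push R p X).2 (rAct s) - (c / 2 * (push R p X).1) • rAct s := by
  have h : push R p (parallelField R c p) = (c, 0) := by
    simp [parallelField, push_proj hR, tangentPart]
  have h0 : ∀ t, pauli 0 t = 0 := fun t => by simpa using smul_pauli 0 0 t
  simp only [beta, cliff, metric, minkowski, h, h0, inner_zero_right, add_zero, pauli_smul,
    pauli_normal_normal, rAct_add, rAct_smul, rAct_pauli]
  module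

lemma push_fst (R : ℝ) (p : Spacetime) (X : Tangent p) : (push R p X).1 = X.1 := by
  rw [push_apply]

/-- The Killing spinor equation as an equation for the flat derivative. -/
lemma spinDeriv_sub_beta_eq_zero_iff {R : ℝ} (hR : R ≠ 0) (c : ℝ) (ψ : Spacetime → Spinor)
    (p : Spacetime) (X : Tangent p) :
    spinDeriv R ψ p X - beta R c p X (ψ p) = 0 ↔
      mvfderiv IM ψ p X = (R⁻¹ / 2) • pauli (push R p X).2 (pauli (normal p) (ψ p)) +
        (c / 4) • pauli (push R p X).2 (rAct (ψ p)) - (c / 2 * X.1) • rAct (ψ p) := by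
  have hR2 : 1 / (2 * R) = R⁻¹ / 2 := by field_simp
  rw [spinDeriv, beta_eq hR, hR2, push_fst, sub_sub, sub_eq_zero]
  constructor <;> intro h <;> rw [h] <;> module

/-- The spinor field `(1 + ε ν r) exp (-a t r) χ`, for a constant spinor `χ`. -/
def spinorField (ε a : ℝ) (χ : Spinor) (p : Spacetime) : Spinor :=
  twist ε p (phase (a * p.1) χ)

lemma mvfderiv_spinorField {R : ℝ} (hR : R ≠ 0) (ε a : ℝ) (χ : Spinor) (p : Spacetime)
    (X : Tangent p) :
    mvfderiv IM (spinorField ε a χ) p X = -(a * X.1) • rAct (spinorField ε a χ p) +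
      (ε * R⁻¹) • pauli (push R p X).2 (rAct (phase (a * p.1) χ)) := by
  obtain ⟨h1, h1'⟩ := mvfderiv_phase a (mdifferentiableAt_const (I := IM) (c := χ) (x := p))
  refine ((mvfderiv_twist hR ε h1).2 X).trans ?_
  rw [h1', mvfderiv_const]
  simp only [zero_apply, zero_sub, spinorField, twist, ← neg_smul, phase_smul, phase_rAct,
    rAct_smul, pauli_smul, rAct_add, rAct_pauli]
  module

lemma contMDiff_spinorField (ε a : ℝ) (χ : Spinor) :
    ContMDiff IM 𝓘(ℝ, Spinor) ∞ (spinorField ε a χ) := by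
  have hn : ContMDiff IM 𝓘(ℝ, E5) ∞ normal := contMDiff_incl.comp contMDiff_snd
  have hph : ContMDiff IM 𝓘(ℝ, Spinor) ∞ (fun q : Spacetime => phase (a * q.1) χ) := by
    have : ContDiff ℝ ∞ (fun t : ℝ => phase (a * t) χ) := by
      unfold phase; fun_prop
    exact this.contMDiff.comp contMDiff_fst
  have hp : ContMDiff IM 𝓘(ℝ, Spinor) ∞
      (fun q : Spacetime => pauliL (normal q) (rActL (phase (a * q.1) χ))) :=
    (pauliL.isBoundedBilinearMap.contDiff.contMDiff).comp
      (hn.prodMk_space (rActL.contMDiff.comp hph))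
  exact hph.add ((contMDiff_const (I := IM) (I' := 𝓘(ℝ, ℝ)) (c := ε)).smul hp)

lemma spinorField_mem_killingSpinors {R ε : ℝ} (hR : R ≠ 0) (hε : ε ^ 2 = 1) (χ : Spinor) :
    spinorField ε (ε * R⁻¹) χ ∈ killingSpinors R (2 * ε * R⁻¹) := by
  refine ⟨contMDiff_spinorField _ _ _, fun p X => ?_⟩
  rw [spinDeriv_sub_beta_eq_zero_iff hR, mvfderiv_spinorField hR]
  simp only [spinorField, twist, rAct_add, rAct_smul, rAct_pauli, rAct_rAct, pauli_add,
    pauli_smul, pauli_neg, pauli_normal_normal]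
  -- The two sides differ by a multiple of `1 - ε²`, from `(ν + ε r)(1 + ε ν r) = 2 ε r + (1 - ε²)
  -- ν`.
  linear_combination (norm := module)
    (R⁻¹ / 2 * hε) • pauli (push R p X).2 (pauli (normal p) (phase (ε * R⁻¹ * p.1) χ))

/-- The inverse transformation, twist by `-ε` and then phase by `-a t`, carries a Killing spinor to
a field with zero flat derivative. -/
lemma exists_eq_spinorField {R ε : ℝ} (hR : R ≠ 0) (hε : ε ^ 2 = 1) {ψ : Spacetime → Spinor}
    (hψ : ψ ∈ killingSpinors R (2 * ε * R⁻¹)) : ∃ χ, spinorField ε (ε * R⁻¹) χ = ψ := by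
  have hd := mdifferentiableAt_of_smooth hψ.1
  set a := ε * R⁻¹ with ha
  have hconst : ∀ p q : Spacetime, phase (-a * p.1) (twist (-ε) p (ψ p)) =
      phase (-a * q.1) (twist (-ε) q (ψ q)) := by
    refine exists_const_of_mvfderiv_eq_zero
      (fun p => (mvfderiv_phase (-a) (mvfderiv_twist hR (-ε) (hd p)).1).1) fun p X => ?_
    obtain ⟨h1, h1'⟩ := mvfderiv_twist hR (-ε) (hd p)
    rw [(mvfderiv_phase (-a) h1).2, h1',
      (spinDeriv_sub_beta_eq_zero_iff hR _ ψ p X).1 (hψ.2 p X)]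
    -- The derivative is the phase applied to a spinor, so it is enough that this spinor vanishes.
    convert phase_zero_right _
    simp only [twist, rAct_add, rAct_sub, rAct_smul, rAct_pauli, rAct_rAct, pauli_add, pauli_sub,
      pauli_smul, pauli_neg, pauli_normal_normal, pauli_normal_push, ha]
    linear_combination (norm := module)
      (-(R⁻¹ / 2) * hε) • pauli (push R p X).2 (pauli (normal p) (ψ p))
  obtain ⟨y⟩ : Nonempty (Metric.sphere (0 : E5) 1) :=
    ⟨⟨EuclideanSpace.single 0 1, by simp⟩⟩
  -- The factor `1/2` undoes `T_ε T_{-ε} = 2`; the choice of base point is immaterial by `hconst`.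
  refine ⟨(1 / 2 : ℝ) • phase (-a * 0) (twist (-ε) (0, y) (ψ (0, y))), funext fun p => ?_⟩
  rw [← hconst p (0, y), spinorField, phase_smul, neg_mul, phase_phase_neg, twist_smul,
    twist_twist_neg hε, smul_smul]
  norm_num

/-- The twist and the phase are invertible on each fibre, so the value at a single point already
determines `χ`. -/
lemma spinorField_injective {ε : ℝ} (hε : ε ^ 2 = 1) (a : ℝ) (p : Spacetime) :
    Function.Injective fun χ => spinorField ε a χ p := by
  have key : ∀ χ, (1 / 2 : ℝ) • phase (-(a * p.1)) (twist (-ε) p (spinorField ε a χ p)) = χ := by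
    intro χ
    have h := twist_twist_neg (ε := -ε) (by rw [neg_sq, hε]) p (phase (a * p.1) χ)
    rw [neg_neg] at h
    rw [spinorField, h, phase_smul, phase_neg_phase, smul_smul]
    norm_num
  intro χ χ' h
  rw [← key χ, ← key χ']
  exact congrArg (fun s => (1 / 2 : ℝ) • phase (-(a * p.1)) (twist (-ε) p s)) h

lemma spinorField_add (ε a : ℝ) (χ χ' : Spinor) :
    spinorField ε a (χ + χ') = spinorField ε a χ + spinorField ε a χ' := by
  funext p; simp only [spinorField, phase_add, twist_add, Pi.add_apply]

lemma spinorField_smul (ε a b : ℝ) (χ : Spinor) :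
    spinorField ε a (b • χ) = b • spinorField ε a χ := by
  funext p; simp only [spinorField, phase_smul, twist_smul, Pi.smul_apply]

lemma spinorField_zero (ε a : ℝ) : spinorField ε a 0 = 0 := by
  simpa using spinorField_smul ε a 0 0

/-- `spinorField` as a linear map. -/
def spinorFieldL (ε a : ℝ) : Spinor →ₗ[ℝ] (Spacetime → Spinor) :=
  ⟨⟨spinorField ε a, spinorField_add ε a⟩, spinorField_smul ε a⟩

lemma spinorFieldL_apply (ε a : ℝ) (χ : Spinor) : spinorFieldL ε a χ = spinorField ε a χ := rfl

lemma spinorFieldL_injective {ε : ℝ} (hε : ε ^ 2 = 1) (a : ℝ) (p : Spacetime) :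
    Function.Injective (spinorFieldL ε a) := fun _ _ h =>
  spinorField_injective hε a p (congrFun h p)

/-- The Killing spinors are parametrised by the constant spinors. -/
lemma killingSpinors_eq_range {R ε : ℝ} (hR : R ≠ 0) (hε : ε ^ 2 = 1) :
    killingSpinors R (2 * ε * R⁻¹) = LinearMap.range (spinorFieldL ε (ε * R⁻¹)) := by
  ext ψ
  exact ⟨fun h => exists_eq_spinorField hR hε h, by
    rintro ⟨χ, rfl⟩; exact spinorField_mem_killingSpinors hR hε χ⟩

/-! ### The covariant derivative of `ξ` and the two-form `dξ♭` -/

/-- The infinitesimal rotation `β₁ R₁₂ + β₂ R₃₄` of `ℝ⁵`. -/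
def rotationL (β₁ β₂ : ℝ) : E5 →ₗ[ℝ] E5 where
  toFun x := β₁ • rotation 0 1 x + β₂ • rotation 2 3 x
  map_add' x y := by simp only [rotation, PiLp.add_apply]; module
  map_smul' a x := by
    simp only [rotation, PiLp.smul_apply, smul_eq_mul, RingHom.id_apply]; module

lemma rotationL_apply (β₁ β₂ : ℝ) (x : E5) :
    rotationL β₁ β₂ x = β₁ • rotation 0 1 x + β₂ • rotation 2 3 x := rfl

lemma inner_rotationL (β₁ β₂ : ℝ) (x y : E5) :
    inner ℝ (rotationL β₁ β₂ x) y = -inner ℝ x (rotationL β₁ β₂ y) := by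
  simp [rotationL_apply, rotation, inner_add_left, inner_add_right, inner_smul_left,
    inner_smul_right, inner_sub_left, inner_sub_right, EuclideanSpace.inner_single_left,
    EuclideanSpace.inner_single_right]
  ring

lemma inner_self_rotationL (β₁ β₂ : ℝ) (x : E5) : inner ℝ x (rotationL β₁ β₂ x) = 0 := by
  have h := inner_rotationL β₁ β₂ x x
  rw [real_inner_comm] at h
  linarith

lemma push_killingField_eq {R : ℝ} (hR : R ≠ 0) (β₁ β₂ : ℝ) (p : Spacetime) :
    push R p (killingField R β₁ β₂ p) = (1, R • rotationL β₁ β₂ (normal p)) := by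
  rw [push_killingField hR, ← rotationL_apply, ← map_smul]; rfl

/-- In the ambient space `ξ` is an affine function of `ν`, so its flat derivative is the same
rotation applied to `∂_X ν = x/R`, and the factors of `R` cancel. -/
lemma push_leviCivita_killingField {R : ℝ} (hR : R ≠ 0) (β₁ β₂ : ℝ) (p : Spacetime)
    (X : Tangent p) :
    push R p (leviCivita R (killingField R β₁ β₂) p X) =
      tangentPart p (0, rotationL β₁ β₂ (push R p X).2) := by
  obtain ⟨hn, hn'⟩ := mvfderiv_normal hR p
  have hg : HasFDerivAt (fun x : E5 => ((1 : ℝ), R • (rotationL β₁ β₂).toContinuousLinearMap x))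
      ((0 : E5 →L[ℝ] ℝ).prod (R • (rotationL β₁ β₂).toContinuousLinearMap)) (normal p) :=
    (hasFDerivAt_const _ _).prodMk
      ((rotationL β₁ β₂).toContinuousLinearMap.hasFDerivAt.const_smul R)
  have h := hg.hasMFDerivAt.comp p hn.hasMFDerivAt
  have hfun : (fun q => push R q (killingField R β₁ β₂ q)) =
      (fun x : E5 => ((1 : ℝ), R • (rotationL β₁ β₂).toContinuousLinearMap x)) ∘ normal := by
    funext q; exact push_killingField_eq hR β₁ β₂ q
  have hd : mvfderiv IM (fun q => push R q (killingField R β₁ β₂ q)) p X =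
      (0, R • rotationL β₁ β₂ (mvfderiv IM normal p X)) := by
    rw [hfun]
    unfold mvfderiv
    rw [h.mfderiv]
    rfl
  rw [leviCivita, push_proj hR, hd, hn', map_smul, smul_inv_smul₀ hR]

/-- The rotation is skew, so the two terms of `dFlat` are equal. -/
lemma dFlat_killingField {R : ℝ} (hR : R ≠ 0) (β₁ β₂ : ℝ) (p : Spacetime) (X Y : Tangent p) :
    dFlat R (killingField R β₁ β₂) p X Y =
      2 * inner ℝ (rotationL β₁ β₂ (push R p X).2) (push R p Y).2 := by
  have h := inner_rotationL β₁ β₂ (push R p X).2 (push R p Y).2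
  rw [real_inner_comm (rotationL β₁ β₂ (push R p Y).2)] at h
  simp only [dFlat, metric, minkowski, push_leviCivita_killingField hR, tangentPart,
    inner_sub_left, real_inner_smul_left, inner_normal_push]
  rw [h]; ring

/-! ### The Clifford action of `dξ♭` -/

/-- The orthogonal projection of `ℝ⁵` onto the tangent space of the sphere. -/
def sphereProj (p : Spacetime) : E5 →ₗ[ℝ] E5 where
  toFun x := x - inner ℝ (normal p) x • normal p
  map_add' x y := by rw [inner_add_right]; module
  map_smul' a x := by rw [inner_smul_right, RingHom.id_apply]; module

lemma sphereProj_apply (p : Spacetime) (x : E5) :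
    sphereProj p x = x - inner ℝ (normal p) x • normal p := rfl

lemma sum_smul_single (x : E5) : ∑ i, x i • (EuclideanSpace.single i 1 : E5) = x := by
  ext j; simp [Finset.sum_apply, Pi.single_apply]

/-- A linear map is recovered from its values on the standard basis. -/
lemma sum_smul_map_single {F : Type*} [AddCommGroup F] [Module ℝ F] (f : E5 →ₗ[ℝ] F) (x : E5) :
    ∑ i, x i • f (EuclideanSpace.single i 1) = f x := by
  conv_rhs => rw [← sum_smul_single x]
  simp only [map_sum, map_smul]

/-- `pauli x s` as a linear map in the vector `x`. -/
def pauliVec (s : Spinor) : E5 →ₗ[ℝ] Spinor where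
  toFun x := pauli x s
  map_add' x y := add_pauli x y s
  map_smul' a x := smul_pauli x a s

lemma pauliVec_apply (s : Spinor) (x : E5) : pauliVec s x = pauli x s := rfl

/-- `pauli x s` as a linear map in the spinor `s`. -/
def pauliSpin (x : E5) : Spinor →ₗ[ℝ] Spinor where
  toFun := pauli x
  map_add' := pauli_add x
  map_smul' := pauli_smul x

lemma pauliSpin_apply (x : E5) (s : Spinor) : pauliSpin x s = pauli x s := rfl

/-- The Clifford contraction `∑ᵢ eᵢ A eᵢ` of a linear map `A` of `ℝ⁵`. -/
def pauliTrace (A : E5 →ₗ[ℝ] E5) (s : Spinor) : Spinor :=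
  ∑ i, pauli (EuclideanSpace.single i 1) (pauli (A (EuclideanSpace.single i 1)) s)

/-- The projection `P` is symmetric and idempotent, so the projected basis resolves the identity of
the tangent space even though it is not a basis. -/
lemma sum_inner_sphereProj (p : Spacetime) (x : E5) (s : Spinor) :
    ∑ j, inner ℝ x (sphereProj p (EuclideanSpace.single j 1)) •
      pauli (sphereProj p (EuclideanSpace.single j 1)) s = pauli (sphereProj p x) s := by
  have h1 : ∀ j, inner ℝ x (sphereProj p (EuclideanSpace.single j 1)) = (sphereProj p x) j := by
    intro j
    simp [sphereProj_apply, inner_sub_right, inner_smul_right, EuclideanSpace.inner_single_right,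
      real_inner_comm x (normal p), mul_comm]
  have h2 : sphereProj p (sphereProj p x) = sphereProj p x := by
    simp only [sphereProj_apply, inner_sub_right, inner_smul_right, norm_normal]
    module
  simp only [h1]
  exact (sum_smul_map_single (pauliVec s ∘ₗ sphereProj p) (sphereProj p x)).trans
    (congrArg (fun y => pauli y s) h2)

/-- Expanding `P = 1 - ν ⟨ν, ·⟩` gives the full trace plus terms in `ν` and `A ν`. These vectors are
orthogonal, hence anticommute, and the terms add up to `2 (A ν) ν`. -/
lemma sum_sphereProj_rotationL (β₁ β₂ : ℝ) (p : Spacetime) (s : Spinor) :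
    ∑ i, pauli (sphereProj p (EuclideanSpace.single i 1))
      (pauli (sphereProj p (rotationL β₁ β₂ (sphereProj p (EuclideanSpace.single i 1)))) s) =
    pauliTrace (rotationL β₁ β₂) s +
      (2 : ℝ) • pauli (rotationL β₁ β₂ (normal p)) (pauli (normal p) s) := by
  set A := rotationL β₁ β₂ with hA
  set n := normal p with hn
  have hinner : ∀ i, inner ℝ n (A (EuclideanSpace.single i 1)) = -(A n) i := by
    intro i
    have h := inner_rotationL β₁ β₂ n (EuclideanSpace.single i 1)
    rw [← hA, EuclideanSpace.inner_single_right] at h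
    simp at h
    linarith
  have hnA : inner ℝ n (A n) = 0 := inner_self_rotationL β₁ β₂ n
  have hni : ∀ i, inner ℝ n (EuclideanSpace.single i 1) = n i := by
    intro i; simp [EuclideanSpace.inner_single_right]
  have hterm : ∀ i, pauli (sphereProj p (EuclideanSpace.single i 1))
      (pauli (sphereProj p (A (sphereProj p (EuclideanSpace.single i 1)))) s) =
      pauli (EuclideanSpace.single i 1) (pauli (A (EuclideanSpace.single i 1)) s)
      - n i • pauliVec (pauli (A n) s) (EuclideanSpace.single i 1)
      + (A n) i • pauliVec (pauli n s) (EuclideanSpace.single i 1)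
      - n i • (pauliSpin n ∘ₗ pauliVec s ∘ₗ A) (EuclideanSpace.single i 1)
      + (n i * n i) • pauli n (pauli (A n) s) - (n i * (A n) i) • s := by
    intro i
    have e1 : sphereProj p (EuclideanSpace.single i 1) =
        EuclideanSpace.single i 1 + (-n i) • n := by
      rw [sphereProj_apply, ← hn, hni]; module
    have e2 : sphereProj p (A (EuclideanSpace.single i 1 + (-n i) • n)) =
        A (EuclideanSpace.single i 1) + (-n i) • A n + (A n) i • n := by
      rw [sphereProj_apply, ← hn, map_add, map_smul, inner_add_right, inner_smul_right, hinner, hnA]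
      module
    rw [e1, e2]
    simp only [add_pauli, smul_pauli, pauli_add, pauli_smul, pauliVec_apply, pauliSpin_apply,
      LinearMap.comp_apply, hn, pauli_normal_normal]
    module
  have hsq : ∑ i, n i * n i = 1 := by
    rw [← norm_normal p, PiLp.inner_apply]; rfl
  have hsk : ∑ i, n i * (A n) i = 0 := by
    rw [← hnA]; simp [PiLp.inner_apply, mul_comm]
  have hanti : pauli n (pauli (A n) s) = -pauli (A n) (pauli n s) := by
    have h := pauli_pauli n (A n) s
    rw [hnA, mul_zero, zero_smul] at h
    exact eq_neg_of_add_eq_zero_left h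
  simp only [hterm, Finset.sum_add_distrib, Finset.sum_sub_distrib, sum_smul_map_single]
  rw [← Finset.sum_smul, ← Finset.sum_smul, hsq, hsk]
  simp only [pauliVec_apply, pauliSpin_apply, LinearMap.comp_apply, hanti, pauliTrace]
  module

lemma push_frame_inr {R : ℝ} (hR : R ≠ 0) (p : Spacetime) (i : Fin 5) :
    push R p (frame R p (.inr i)) = (0, sphereProj p (EuclideanSpace.single i 1)) := by
  rw [frame, push_proj hR]; rfl

lemma push_frame_inl {R : ℝ} (hR : R ≠ 0) (p : Spacetime) (u : Unit) :
    push R p (frame R p (.inl u)) = (1, 0) := by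
  rw [frame, push_proj hR]; simp [tangentPart, axis]

lemma twoFormAct_dFlat_killingField {R : ℝ} (hR : R ≠ 0) (β₁ β₂ : ℝ) (p : Spacetime) (s : Spinor) :
    twoFormAct R p (dFlat R (killingField R β₁ β₂) p) s =
      -(pauliTrace (rotationL β₁ β₂) s +
        (2 : ℝ) • pauli (rotationL β₁ β₂ (normal p)) (pauli (normal p) s)) := by
  -- Tangent `x`, `y` act by `x ν` and `y ν`, and `x ν y ν = -x y`; this is the origin of the
  -- overall sign.
  have hcl : ∀ i j, cliff R p (frame R p (.inr i)) (cliff R p (frame R p (.inr j)) s) =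
      -pauli (sphereProj p (EuclideanSpace.single i 1))
        (pauli (sphereProj p (EuclideanSpace.single j 1)) s) := by
    intro i j
    have h := pauli_normal_push R p (frame R p (.inr j)) (pauli (normal p) s)
    simp only [push_frame_inr hR, pauli_normal_normal] at h
    simp only [cliff, push_frame_inr hR, zero_smul, zero_add, h, pauli_neg]
  have hi : ∀ i, ∑ j, (2 * inner ℝ (rotationL β₁ β₂ (sphereProj p (EuclideanSpace.single i 1)))
        (sphereProj p (EuclideanSpace.single j 1))) •
      -pauli (sphereProj p (EuclideanSpace.single i 1))
        (pauli (sphereProj p (EuclideanSpace.single j 1)) s) =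
      (-2 : ℝ) • pauli (sphereProj p (EuclideanSpace.single i 1))
        (pauli (sphereProj p (rotationL β₁ β₂ (sphereProj p (EuclideanSpace.single i 1)))) s) := by
    intro i
    rw [← sum_inner_sphereProj p (rotationL β₁ β₂ _), ← pauliSpin_apply, map_sum, Finset.smul_sum]
    refine Finset.sum_congr rfl fun j _ => ?_
    rw [map_smul, pauliSpin_apply]
    module
  rw [← sum_sphereProj_rotationL, twoFormAct]
  simp only [Fintype.sum_sum_type, dFlat_killingField hR, push_frame_inl hR, map_zero,
    inner_zero_left, inner_zero_right, mul_zero, zero_smul, Finset.sum_const_zero, zero_add]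
  simp only [axisSign, one_mul, push_frame_inr hR, hcl, hi, ← Finset.smul_sum]
  module

/-! ### The spin lift of the rotation and `L_ξ` on constant spinors -/

/-- The action on `Σ` of the infinitesimal rotation `β₁ R₁₂ + β₂ R₃₄`. -/
def spinRotation (β₁ β₂ : ℝ) (s : Spinor) : Spinor :=
  ![((β₂ - β₁) / 2) • (quat 0 0 0 1 * s 0), (-(β₁ + β₂) / 2) • (quat 0 0 0 1 * s 1)]

/-- The trace is `2 β₁ e₁ e₂ + 2 β₂ e₃ e₄`. In this matrix model `e₁ e₂` is left multiplication by
`-k` on both coordinates and `e₃ e₄` is `k` on one and `-k` on the other, whence the diagonal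
entries. -/
lemma pauliTrace_rotationL (β₁ β₂ : ℝ) (s : Spinor) :
    pauliTrace (rotationL β₁ β₂) s = (4 : ℝ) • spinRotation β₁ β₂ s := by
  funext k
  fin_cases k <;> ext <;>
    simp [pauliTrace, rotationL_apply, rotation, pauli, spinRotation, Fin.sum_univ_succ] <;> ring

/-- The commutator `[S, x] = -A x` is what makes `S` a lift of the rotation; with `x = ν` it
measures the failure of `S` to commute with the twist. -/
lemma spinRotation_pauli (β₁ β₂ : ℝ) (x : E5) (s : Spinor) :
    spinRotation β₁ β₂ (pauli x s) =
      pauli x (spinRotation β₁ β₂ s) - pauli (rotationL β₁ β₂ x) s := by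
  funext k
  fin_cases k <;> ext <;> simp [rotationL_apply, rotation, pauli, spinRotation] <;> ring

lemma spinRotation_add (β₁ β₂ : ℝ) (s t : Spinor) :
    spinRotation β₁ β₂ (s + t) = spinRotation β₁ β₂ s + spinRotation β₁ β₂ t := by
  funext k; fin_cases k <;> simp [spinRotation, mul_add]

lemma spinRotation_smul (β₁ β₂ a : ℝ) (s : Spinor) :
    spinRotation β₁ β₂ (a • s) = a • spinRotation β₁ β₂ s := by
  funext k; fin_cases k <;> simp [spinRotation, smul_comm a]

lemma spinRotation_rAct (β₁ β₂ : ℝ) (s : Spinor) :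
    spinRotation β₁ β₂ (rAct s) = rAct (spinRotation β₁ β₂ s) := by
  funext k; fin_cases k <;> simp [spinRotation, rAct, mul_assoc]

/-- The operator on constant spinors which corresponds to `L_ξ` on Killing spinors. -/
def weightOp (β₁ β₂ a : ℝ) : Spinor →ₗ[ℝ] Spinor where
  toFun s := spinRotation β₁ β₂ s - a • rAct s
  map_add' s t := by rw [spinRotation_add, rAct_add]; module
  map_smul' b s := by rw [spinRotation_smul, rAct_smul, RingHom.id_apply]; module

lemma weightOp_apply (β₁ β₂ a : ℝ) (s : Spinor) :
    weightOp β₁ β₂ a s = spinRotation β₁ β₂ s - a • rAct s := rfl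

lemma spinRotation_phase (β₁ β₂ θ : ℝ) (s : Spinor) :
    spinRotation β₁ β₂ (phase θ s) = phase θ (spinRotation β₁ β₂ s) := by
  simp only [phase, sub_eq_add_neg, ← neg_smul, spinRotation_add, spinRotation_smul,
    spinRotation_rAct]

/-- The shape operator contributes `-(1/2) (A ν) ν` and the two-form `S + (1/2) (A ν) ν`, so the
normal terms cancel. -/
lemma lieDeriv_killingField {R : ℝ} (hR : R ≠ 0) (β₁ β₂ : ℝ) (ψ : Spacetime → Spinor)
    (p : Spacetime) :
    lieDeriv R (killingField R β₁ β₂) ψ p =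
      mvfderiv IM ψ p (killingField R β₁ β₂ p) + spinRotation β₁ β₂ (ψ p) := by
  have h : 1 / (2 * R) * R = 1 / 2 := by field_simp
  rw [lieDeriv, spinDeriv, twoFormAct_dFlat_killingField hR, pauliTrace_rotationL,
    push_killingField_eq hR, smul_pauli, smul_smul, h]
  module

/-- Differentiating `ν` in the twist along `ξ` gives `A ν`, which cancels the commutator `[S, ν] =
-A ν`. Only `S` and the time derivative `-a r` of the phase act on `χ`. -/
lemma lieDeriv_spinorField {R : ℝ} (hR : R ≠ 0) (β₁ β₂ ε a : ℝ) (χ : Spinor) (p : Spacetime) :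
    lieDeriv R (killingField R β₁ β₂) (spinorField ε a χ) p =
      spinorField ε a (weightOp β₁ β₂ a χ) p := by
  have ht : (killingField R β₁ β₂ p).1 = 1 := by rw [← push_fst R, push_killingField_eq hR]
  rw [lieDeriv_killingField hR, mvfderiv_spinorField hR, ht, push_killingField_eq hR, smul_pauli,
    smul_smul, mul_assoc, inv_mul_cancel₀ hR, weightOp_apply, sub_eq_add_neg, ← neg_smul,
    spinorField_add, spinorField_smul]
  simp only [spinorField, twist, spinRotation_add, spinRotation_smul, spinRotation_pauli,
    spinRotation_rAct, spinRotation_phase, Pi.add_apply, Pi.smul_apply, phase_rAct, rAct_add,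
    rAct_smul, rAct_pauli]
  module

/-- The invariant Killing spinors are parametrised by the kernel of `weightOp`. -/
lemma invariantKillingSpinors_eq_map {R ε : ℝ} (hR : R ≠ 0) (hε : ε ^ 2 = 1) (β₁ β₂ : ℝ)
    (p : Spacetime) :
    invariantKillingSpinors R (2 * ε * R⁻¹) (killingField R β₁ β₂) =
      (LinearMap.ker (weightOp β₁ β₂ (ε * R⁻¹))).map (spinorFieldL ε (ε * R⁻¹)) := by
  ext ψ
  constructor
  · rintro ⟨h1, h2⟩
    obtain ⟨χ, rfl⟩ := exists_eq_spinorField hR hε h1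
    refine ⟨χ, ?_, rfl⟩
    -- Invariance at one point suffices, by injectivity of evaluation there.
    have h3 := h2 p
    rw [lieDeriv_spinorField hR] at h3
    exact spinorField_injective hε (ε * R⁻¹) p
      (h3.trans (congrFun (spinorField_zero ε (ε * R⁻¹)) p).symm)
  · rintro ⟨χ, hχ, rfl⟩
    refine ⟨spinorField_mem_killingSpinors hR hε χ, fun q => ?_⟩
    rw [spinorFieldL_apply, lieDeriv_spinorField hR, LinearMap.mem_ker.1 hχ, spinorField_zero]
    rfl

/-! ### Weight spaces and dimension count -/

/-- The quaternions `q` with `m k q = a q i`. -/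
def weightSpace (m a : ℝ) : Submodule ℝ ℍ[ℝ] where
  carrier := {q | m • (quat 0 0 0 1 * q) = a • (q * quat 0 1 0 0)}
  zero_mem' := by simp
  add_mem' := by
    intro q q' h h'
    simp only [Set.mem_ofPred_eq, mul_add, add_mul, smul_add] at *
    rw [h, h']
  smul_mem' := by
    intro b q h
    simp only [Set.mem_ofPred_eq, mul_smul_comm, smul_mul_assoc, smul_comm _ b] at *
    rw [h]

lemma mem_weightSpace {m a : ℝ} {q : ℍ[ℝ]} : q ∈ weightSpace m a ↔
    m * q.imK = a * q.imI ∧ -(m * q.imJ) = a * q.re ∧ m * q.imI = a * q.imK ∧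
      m * q.re = -(a * q.imJ) := by
  change m • (quat 0 0 0 1 * q) = a • (q * quat 0 1 0 0) ↔ _
  rw [Quaternion.ext_iff]
  simp

/-- For `m² = a²` the space `weightSpace m a` has coordinates the real part and the `i`-part. -/
def weightSpaceEquiv {m a : ℝ} (ha : a ≠ 0) (h : m ^ 2 = a ^ 2) : weightSpace m a ≃ₗ[ℝ] ℝ × ℝ where
  toFun q := (q.1.re, q.1.imI)
  map_add' _ _ := rfl
  map_smul' _ _ := rfl
  -- Two of the four coordinate equations give the `j`- and `k`-parts; the other two then follow
  -- from `m² = a²`.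
  invFun z := ⟨quat z.1 z.2 (-(m / a) * z.1) (m / a * z.2), by
    rw [mem_weightSpace]
    simp only [quat_re, quat_imI, quat_imJ, quat_imK]
    refine ⟨?_, ?_, ?_, ?_⟩ <;> field_simp <;> rw [h]⟩
  left_inv q := by
    obtain ⟨h1, h2, h3, h4⟩ := mem_weightSpace.1 q.2
    ext
    · rfl
    · rfl
    · change -(m / a) * q.1.re = q.1.imJ
      field_simp
      linarith
    · change m / a * q.1.imI = q.1.imK
      field_simp
      linarith
  right_inv _ := rfl

/-- Applying `m k q = a q i` twice gives `m² q = a² q`; the combinations below are its four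
coordinates. -/
lemma weightSpace_eq_bot {m a : ℝ} (h : m ^ 2 ≠ a ^ 2) : weightSpace m a = ⊥ := by
  have hd : m ^ 2 - a ^ 2 ≠ 0 := sub_ne_zero.2 h
  refine (Submodule.eq_bot_iff _).2 fun q hq => ?_
  obtain ⟨h1, h2, h3, h4⟩ := mem_weightSpace.1 hq
  ext <;> refine (mul_eq_zero.1 (?_ : (m ^ 2 - a ^ 2) * _ = 0)).resolve_left hd
  · linear_combination m * h4 + a * h2
  · linear_combination m * h3 + a * h1
  · linear_combination -m * h2 - a * h4
  · linear_combination m * h1 + a * h3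

lemma finrank_weightSpace {m a : ℝ} (ha : a ≠ 0) :
    Module.finrank ℝ (weightSpace m a) = if m ^ 2 = a ^ 2 then 2 else 0 := by
  split_ifs with h
  · rw [(weightSpaceEquiv ha h).finrank_eq]; simp
  · rw [weightSpace_eq_bot h, finrank_bot]

lemma mem_ker_weightOp {β₁ β₂ a : ℝ} {s : Spinor} : s ∈ LinearMap.ker (weightOp β₁ β₂ a) ↔
    ∀ k, s k ∈ weightSpace (![(β₂ - β₁) / 2, -(β₁ + β₂) / 2] k) a := by
  rw [LinearMap.mem_ker, weightOp_apply, sub_eq_zero, funext_iff, Fin.forall_fin_two,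
    Fin.forall_fin_two]
  rfl

/-- The kernel of `weightOp` is a product of two weight spaces. -/
def kerWeightOpEquiv (β₁ β₂ a : ℝ) : LinearMap.ker (weightOp β₁ β₂ a) ≃ₗ[ℝ]
    ((k : Fin 2) → weightSpace (![(β₂ - β₁) / 2, -(β₁ + β₂) / 2] k) a) where
  toFun s k := ⟨s.1 k, mem_ker_weightOp.1 s.2 k⟩
  map_add' _ _ := rfl
  map_smul' _ _ := rfl
  invFun s := ⟨fun k => (s k).1, mem_ker_weightOp.2 fun k => (s k).2⟩
  left_inv _ := rfl
  right_inv _ := rfl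

lemma finrank_ker_weightOp (β₁ β₂ : ℝ) {a : ℝ} (ha : a ≠ 0) :
    Module.finrank ℝ (LinearMap.ker (weightOp β₁ β₂ a)) =
      (if (β₁ - β₂) ^ 2 = (2 * a) ^ 2 then 2 else 0) +
        if (β₁ + β₂) ^ 2 = (2 * a) ^ 2 then 2 else 0 := by
  have h1 : ((β₂ - β₁) / 2) ^ 2 = a ^ 2 ↔ (β₁ - β₂) ^ 2 = (2 * a) ^ 2 := by
    constructor <;> intro h <;> linarith
  have h2 : (-(β₁ + β₂) / 2) ^ 2 = a ^ 2 ↔ (β₁ + β₂) ^ 2 = (2 * a) ^ 2 := by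
    constructor <;> intro h <;> linarith
  rw [(kerWeightOpEquiv β₁ β₂ a).finrank_eq, Module.finrank_pi_fintype, Fin.sum_univ_two,
    finrank_weightSpace ha, finrank_weightSpace ha]
  simp only [Matrix.cons_val_zero, Matrix.cons_val_one, h1, h2]

lemma finrank_spinor : Module.finrank ℝ Spinor = 8 := by
  rw [Module.finrank_pi_fintype]
  simp [Quaternion.finrank_eq_four]

end TimeSphere

end

open TimeSphere
theorem proposition3p2 (R c : ℝ) (hR : 0 < R) (p₀ : Spacetime)
    (hφ : R ^ 2 * metric R p₀ (parallelField R c p₀) (parallelField R c p₀) = -4) :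
    Module.finrank ℝ (killingSpinors R c) = Module.finrank ℝ Spinor ∧
    ∀ β₁ β₂ : ℝ,
      ((∃ ψ ∈ invariantKillingSpinors R c (killingField R β₁ β₂), ψ ≠ 0) ↔
        (β₁ + β₂) ^ 2 = -metric R p₀ (parallelField R c p₀) (parallelField R c p₀) ∨
        (β₁ - β₂) ^ 2 = -metric R p₀ (parallelField R c p₀) (parallelField R c p₀)) ∧
      ((∃ ψ ∈ invariantKillingSpinors R c (killingField R β₁ β₂), ψ ≠ 0) →
        preservedFraction R c (killingField R β₁ β₂) =
          if β₁ * β₂ = 0 then 1 / 2 else 1 / 4) := by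
  have hR0 : R ≠ 0 := hR.ne'
  rw [metric_parallelField hR0] at hφ ⊢
  -- With `ε = c R / 2` the hypothesis `R² c² = 4` becomes `ε² = 1`; the sign of `c` stays free.
  obtain ⟨ε, rfl⟩ : ∃ ε, c = 2 * ε * R⁻¹ := ⟨c * R / 2, by field_simp⟩
  have hε : ε ^ 2 = 1 := by
    field_simp at hφ
    linarith
  have ha : ε * R⁻¹ ≠ 0 := mul_ne_zero (by rintro rfl; norm_num at hε) (inv_ne_zero hR0)
  have hinj := spinorFieldL_injective hε (ε * R⁻¹) p₀
  refine ⟨?_, fun β₁ β₂ => ?_⟩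
  · rw [killingSpinors_eq_range hR0 hε, LinearMap.finrank_range_of_inj hinj]
  · set c := 2 * ε * R⁻¹ with hc
    have hdim : Module.finrank ℝ (invariantKillingSpinors R c (killingField R β₁ β₂)) =
        (if (β₁ - β₂) ^ 2 = c ^ 2 then 2 else 0) + if (β₁ + β₂) ^ 2 = c ^ 2 then 2 else 0 := by
      rw [invariantKillingSpinors_eq_map hR0 hε β₁ β₂ p₀,
        (Submodule.equivMapOfInjective _ hinj _).symm.finrank_eq, finrank_ker_weightOp β₁ β₂ ha,
        hc, mul_assoc]
    -- `finrank` is `0` by default in infinite dimension, so finiteness is needed to read `finrank =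
    -- 0` as the zero space.
    have hfin : FiniteDimensional ℝ (invariantKillingSpinors R c (killingField R β₁ β₂)) := by
      rw [invariantKillingSpinors_eq_map hR0 hε β₁ β₂ p₀]; infer_instance
    have hiff : (∃ ψ ∈ invariantKillingSpinors R c (killingField R β₁ β₂), ψ ≠ 0) ↔
        (β₁ + β₂) ^ 2 = c ^ 2 ∨ (β₁ - β₂) ^ 2 = c ^ 2 := by
      rw [← Submodule.ne_bot_iff, Ne, ← Submodule.finrank_eq_zero (R := ℝ), hdim]
      split_ifs <;> simp_all
    refine ⟨by rw [hiff, neg_neg], fun hex => ?_⟩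
    have h := hiff.1 hex
    rw [preservedFraction, hdim, finrank_spinor]
    -- The squares `(β₁ - β₂)²` and `(β₁ + β₂)²` differ by `4 β₁ β₂`: either the conditions coincide
    -- and both weight spaces contribute, or exactly one does.
    by_cases hβ : β₁ * β₂ = 0
    · have he : (β₁ - β₂) ^ 2 = (β₁ + β₂) ^ 2 := by linear_combination -4 * hβ
      rw [he, or_self] at h
      rw [he, if_pos h, if_pos hβ]
      norm_num
    · have he : (β₁ - β₂) ^ 2 ≠ (β₁ + β₂) ^ 2 := fun he => hβ (by linarith)
      rw [if_neg hβ]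
      rcases h with h | h
      · rw [if_pos h, if_neg (fun h' => he (h'.trans h.symm))]
        norm_num
      · rw [if_pos h, if_neg (fun h' => he (h.trans h'.symm))]
        norm_num
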